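/- Let $\Bbbk$ be an algebraically closed field and let $A=\Bbbk Q/\langle R\rangle$ be a basic finite-dimensional $\Bbbk$-algebra, given by a finite quiver $Q$ with vertex set $\mathbf N$ and relations $R$ generating an admissible ideal. Let $\tilde A$ be the algebra obtained from $A$ by attaching to $Q$, for every vertex $k$, a new vertex $\tilde k$ and an arrow $k\to\tilde k$, and keeping the relations $R$. Put $\tilde{\mathbf N}=\{\tilde k: k\in\mathbf N\}$ and $\overline{\mathbf N}=\mathbf N\cup\tilde{\mathbf N}$, and let $N$ be the nilpotency degree of $\mathrm{Rad}\,\tilde A$. For $m\in\mathbb Z$ put $I_m=(\mathrm{Rad}\,\tilde A)^{\max(m,0)}$ (so $I_m=\tilde A$ for $m\le 0$ and $I_m=0$ for $m\ge N$). Regard $\tilde A$ as a $\Bbbk$-linear category with object set $\overline{\mathbf N}$ and $\tilde A(x,y)=e_y\tilde Ae_x$. Let $\mathfrak C=\mathfrak C(\tilde A)$ be the $\Bbbk$-linear category with objects $(x,i)$, $x\in\overline{\mathbf N}$, $i\in\mathbb Z$, with morphism spaces $$e_{y,j}\mathfrak C e_{x,i}=\mathfrak C\big((x,i),(y,j)\big)=e_y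 I_{j-i}e_x\,/\,e_y I_{N+j-i}e_x$$ and composition induced by the multiplication of $\tilde A$. Let $\mathfrak D=\mathfrak D(\tilde A)$ be the trivial extension of $\mathfrak C$ by its restricted dual bimodule $\mathfrak C^*=\bigoplus_{x,y,i,j}\mathrm{Hom}_{\Bbbk}(e_{y,j}\mathfrak C e_{x,i},\Bbbk)$. Define the (extended) first order on $\overline{\mathbf N}\times\mathbb Z$ by: $(k,i)>(l,j)$ if $i>j$, or if $i=j$, $k\in\mathbf N$ and $l\in\tilde{\mathbf N}$. For $\mathfrak X\in\{\mathfrak C,\mathfrak D\}$ let the left standard module $\Delta^{1,l}_{\mathfrak X}(k,i)$ be the quotient of the left projective $\mathfrak Xe_{k,i}$ by the trace in it of all $\mathfrak Xe_{l,j}$ with $(l,j)>(k,i)$. Then: 1. $\mathfrak D$ is symmetric, i.e. it carries a non-degenerate symmetric associative bilinear form given by a trace form on the spaces $e_{k,i}\mathfrak De_{k,i}$. 2. $\mathfrak D$ is quasi-hereditary with respect to the first order. That is: $\mathfrak D$ is a basic $\Bbbk$-linear category with finite-dimensional indecomposable projectives and injectives; the order is an interval-finite partial order; each $\Delta^{1,l}_{\mathfrak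 D}(k,i)$ contains the simple module $L(k,i)$ with multiplicity one, and all its other composition factors are of the form $L(l,j)$ with $(l,j)<(k,i)$; and the kernel of $\mathfrak De_{k,i}\to\Delta^{1,l}_{\mathfrak D}(k,i)$ has a finite filtration with subquotients of the form $\Delta^{1,l}_{\mathfrak D}(l,j)$, $(l,j)>(k,i)$. 3. For all $k\in\overline{\mathbf N}$ and $i\in\mathbb Z$ there is an isomorphism of left $\mathfrak D$-modules $\Delta^{1,l}_{\mathfrak D}(k,i)\cong\Delta^{1,l}_{\mathfrak C}(k,i)$, where $\mathfrak C$-modules are regarded as $\mathfrak D$-modules through the projection $\mathfrak D\to\mathfrak C$ with kernel $\mathfrak C^*$. -/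

import Mathlib

open CategoryTheory

universe w v u

namespace QHEnvelope

/-! ## Two-sided ideals of `k`-linear categories

A "`k`-algebra" (possibly infinite-dimensional, without unit) is a `k`-linear category `C`;
for objects `x`, `y` the space `e_y C e_x` is the space `x ⟶ y` of morphisms, so that left
modules are covariant functors. -/

section Ideals

variable (k : Type w) [Field k] (C : Type u) [Category.{v} C] [Preadditive C] [Linear k C]

/-- A two-sided ideal of a `k`-linear category. -/
@[ext]
structure HomIdeal where
  /-- the morphisms `x ⟶ y` in the ideal -/
  hom : ∀ x y : C, Submodule k (x ⟶ y)
  /-- stability under precomposition -/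
  comp_left : ∀ {x y z : C} (a : x ⟶ y) {f : y ⟶ z}, f ∈ hom y z → a ≫ f ∈ hom x z
  /-- stability under postcomposition -/
  comp_right : ∀ {x y z : C} {f : x ⟶ y} (b : y ⟶ z), f ∈ hom x y → f ≫ b ∈ hom x z

namespace HomIdeal

variable {k C}

instance : LE (HomIdeal k C) := ⟨fun I J => ∀ x y, I.hom x y ≤ J.hom x y⟩

instance : Top (HomIdeal k C) :=
  ⟨{ hom := fun _ _ => ⊤
     comp_left := fun _ _ _ => Submodule.mem_top
     comp_right := fun _ _ => Submodule.mem_top }⟩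

instance : Bot (HomIdeal k C) :=
  ⟨{ hom := fun _ _ => ⊥
     comp_left := fun a f hf => by
       rw [Submodule.mem_bot] at hf ⊢
       rw [hf, Limits.comp_zero]
     comp_right := fun b hf => by
       rw [Submodule.mem_bot] at hf ⊢
       rw [hf, Limits.zero_comp] }⟩

/-- The two-sided ideal generated by a family of sets of morphisms. -/
def span (S : ∀ x y : C, Set (x ⟶ y)) : HomIdeal k C where
  hom x y := Submodule.span k
    {f | ∃ (x' y' : C) (a : x ⟶ x') (r : x' ⟶ y') (b : y' ⟶ y), r ∈ S x' y' ∧ f = a ≫ r ≫ b}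
  comp_left {x y z} a f hf := by
    induction hf using Submodule.span_induction with
    | mem f h =>
      obtain ⟨x', y', c, r, b, hr, rfl⟩ := h
      exact Submodule.subset_span ⟨x', y', a ≫ c, r, b, hr, by simp⟩
    | zero => simp
    | add f g _ _ hf hg => rw [Preadditive.comp_add]; exact add_mem hf hg
    | smul c f _ hf => rw [Linear.comp_smul]; exact Submodule.smul_mem _ c hf
  comp_right {x y z} f b hf := by
    induction hf using Submodule.span_induction with
    | mem f h =>
      obtain ⟨x', y', c, r, d, hr, rfl⟩ := h
      exact Submodule.subset_span ⟨x', y', c, r, d ≫ b, hr, by simp⟩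
    | zero => simp
    | add f g _ _ hf hg => rw [Preadditive.add_comp]; exact add_mem hf hg
    | smul c f _ hf => rw [Linear.smul_comp]; exact Submodule.smul_mem _ c hf

/-- The product of two ideals: sums of composites of a morphism of `I` with one of `J`. -/
def mul (I J : HomIdeal k C) : HomIdeal k C where
  hom x y := Submodule.span k
    {f | ∃ (z : C) (a : x ⟶ z) (b : z ⟶ y), a ∈ I.hom x z ∧ b ∈ J.hom z y ∧ f = a ≫ b}
  comp_left {x y z} a f hf := by
    induction hf using Submodule.span_induction with
    | mem f h =>
      obtain ⟨t, c, d, hc, hd, rfl⟩ := h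
      exact Submodule.subset_span ⟨t, a ≫ c, d, I.comp_left a hc, hd, by simp⟩
    | zero => simp
    | add f g _ _ hf hg => rw [Preadditive.comp_add]; exact add_mem hf hg
    | smul c f _ hf => rw [Linear.comp_smul]; exact Submodule.smul_mem _ c hf
  comp_right {x y z} f b hf := by
    induction hf using Submodule.span_induction with
    | mem f h =>
      obtain ⟨t, c, d, hc, hd, rfl⟩ := h
      exact Submodule.subset_span ⟨t, c, d ≫ b, hc, J.comp_right b hd, by simp⟩
    | zero => simp
    | add f g _ _ hf hg => rw [Preadditive.add_comp]; exact add_mem hf hg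
    | smul c f _ hf => rw [Linear.smul_comp]; exact Submodule.smul_mem _ c hf

/-- Powers of an ideal; the zeroth power is the whole category. -/
def pow (I : HomIdeal k C) : ℕ → HomIdeal k C
  | 0 => ⊤
  | n + 1 => (pow I n).mul I

theorem pow_succ_le (I : HomIdeal k C) (n : ℕ) : I.pow (n + 1) ≤ I.pow n := by
  intro x y
  refine Submodule.span_le.2 ?_
  rintro _ ⟨z, a, b, ha, -, rfl⟩
  exact (I.pow n).comp_right b ha

theorem pow_anti (I : HomIdeal k C) {m n : ℕ} (h : m ≤ n) : I.pow n ≤ I.pow m := by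
  induction n, h using Nat.le_induction with
  | base => exact fun _ _ => le_rfl
  | succ n _ ih => exact fun x y => (I.pow_succ_le n x y).trans (ih x y)

theorem comp_mem_pow (I : HomIdeal k C) {m n l : ℕ} (hl : l ≤ m + n) {x y z : C} {f : x ⟶ y}
    {g : y ⟶ z} (hf : f ∈ (I.pow m).hom x y) (hg : g ∈ (I.pow n).hom y z) :
    f ≫ g ∈ (I.pow l).hom x z := by
  refine I.pow_anti hl x z ?_
  clear hl
  induction n generalizing z with
  | zero => exact (I.pow m).comp_right g hf
  | succ n ih =>
    change g ∈ Submodule.span k _ at hg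
    induction hg using Submodule.span_induction with
    | mem g h =>
      obtain ⟨t, a, b, ha, hb, rfl⟩ := h
      exact Submodule.subset_span ⟨t, f ≫ a, b, ih ha, hb, by simp⟩
    | zero => simp
    | add g g' _ _ h h' => rw [Preadditive.comp_add]; exact add_mem h h'
    | smul c g _ h => rw [Linear.comp_smul]; exact Submodule.smul_mem _ c h

/-- The nilpotency degree of a nilpotent ideal `I`: the least `n` with `I ^ n = 0`. -/
noncomputable def nilpotencyDegree (I : HomIdeal k C) : ℕ := sInf {n | I.pow n = ⊥}

end HomIdeal

/-- The (Jacobson) radical of a `k`-linear category: the morphisms `f : x ⟶ y` such that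
`1 - g f` is invertible for all `g : y ⟶ x`. -/
def radical : HomIdeal k C where
  hom x y :=
    { carrier := {f | ∀ g : y ⟶ x, IsIso (𝟙 x - f ≫ g)}
      zero_mem' := fun g => by
        have h : 𝟙 x - (0 : x ⟶ y) ≫ g = 𝟙 x := by simp
        rw [h]; infer_instance
      add_mem' := fun {f f'} hf hf' g => by
        have := hf g
        have := hf' (g ≫ inv (𝟙 x - f ≫ g))
        have h : 𝟙 x - (f + f') ≫ g =
            (𝟙 x - f' ≫ g ≫ inv (𝟙 x - f ≫ g)) ≫ (𝟙 x - f ≫ g) := by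
          conv_rhs => rw [Preadditive.sub_comp]
          simp only [Category.assoc, IsIso.inv_hom_id, Category.comp_id, Category.id_comp,
            Preadditive.add_comp]
          abel
        rw [h]; infer_instance
      smul_mem' := fun c f hf g => by
        have h : (c • f) ≫ g = f ≫ (c • g) := by simp
        rw [h]; exact hf _ }
  comp_left {x y z} a f hf g := by
    have : IsIso (𝟙 y - f ≫ g ≫ a) := hf (g ≫ a)
    set r : y ⟶ y := inv (𝟙 y - f ≫ g ≫ a) with hr
    have h1 : (𝟙 y - f ≫ g ≫ a) ≫ r = 𝟙 y := IsIso.hom_inv_id _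
    have h2 : r ≫ (𝟙 y - f ≫ g ≫ a) = 𝟙 y := IsIso.inv_hom_id _
    rw [Preadditive.sub_comp, Category.id_comp, sub_eq_iff_eq_add] at h1
    rw [Preadditive.comp_sub, Category.comp_id, sub_eq_iff_eq_add] at h2
    refine ⟨⟨𝟙 x + a ≫ r ≫ f ≫ g, ?_, ?_⟩⟩
    · have h3 : a ≫ r ≫ f ≫ g = a ≫ f ≫ g + a ≫ f ≫ g ≫ a ≫ r ≫ f ≫ g := by
        conv_lhs => rw [h1]
        simp
      simp only [Preadditive.comp_add, Preadditive.sub_comp, Category.assoc, Category.id_comp,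
        Category.comp_id]
      rw [← sub_eq_zero] at h3 ⊢
      rw [← h3]; abel
    · have h3 : a ≫ r ≫ f ≫ g = a ≫ f ≫ g + a ≫ r ≫ f ≫ g ≫ a ≫ f ≫ g := by
        conv_lhs => rw [h2]
        simp
      simp only [Preadditive.comp_sub, Preadditive.add_comp, Category.assoc, Category.id_comp,
        Category.comp_id]
      rw [← sub_eq_zero] at h3 ⊢
      rw [← h3]; abel
  comp_right {x y z} f b hf g := by
    rw [Category.assoc]; exact hf (b ≫ g)

end Ideals

/-! ## Quotient categories -/

section Quotient

variable {k : Type w} [Field k] {C : Type u} [Category.{v} C] [Preadditive C] [Linear k C]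

/-- The quotient `C / I` of a `k`-linear category by a two-sided ideal. -/
structure QuotCat (I : HomIdeal k C) where
  /-- the underlying object -/
  as : C

namespace QuotCat

variable (I : HomIdeal k C)

/-- Composition in `C / I`. -/
def comp {x y z : C} (f : (x ⟶ y) ⧸ I.hom x y) (g : (y ⟶ z) ⧸ I.hom y z) :
    (x ⟶ z) ⧸ I.hom x z :=
  Quotient.map₂ (fun (a : x ⟶ y) (b : y ⟶ z) => a ≫ b)
    (fun a a' ha b b' hb => by
      have ha' : a - a' ∈ I.hom x y := (Submodule.quotientRel_def _).1 ha
      have hb' : b - b' ∈ I.hom y z := (Submodule.quotientRel_def _).1 hb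
      refine (Submodule.quotientRel_def _).2 ?_
      have h : a ≫ b - a' ≫ b' = (a - a') ≫ b + a' ≫ (b - b') := by simp
      rw [h]
      exact add_mem (I.comp_right b ha') (I.comp_left a' hb')) f g

instance : Category.{v} (QuotCat I) where
  Hom X Y := (X.as ⟶ Y.as) ⧸ I.hom X.as Y.as
  id X := Submodule.Quotient.mk (𝟙 X.as)
  comp f g := comp I f g
  id_comp f := by
    induction f using Submodule.Quotient.induction_on with
    | _ f => exact congrArg Submodule.Quotient.mk (Category.id_comp f)
  comp_id f := by
    induction f using Submodule.Quotient.induction_on with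
    | _ f => exact congrArg Submodule.Quotient.mk (Category.comp_id f)
  assoc f g h := by
    induction f using Submodule.Quotient.induction_on with
    | _ f =>
    induction g using Submodule.Quotient.induction_on with
    | _ g =>
    induction h using Submodule.Quotient.induction_on with
    | _ h => exact congrArg Submodule.Quotient.mk (Category.assoc f g h)

instance : Preadditive (QuotCat I) where
  homGroup X Y := inferInstanceAs (AddCommGroup ((X.as ⟶ Y.as) ⧸ I.hom X.as Y.as))
  add_comp X Y Z f f' g := by
    induction f using Submodule.Quotient.induction_on with
    | _ f =>
    induction f' using Submodule.Quotient.induction_on with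
    | _ f' =>
    induction g using Submodule.Quotient.induction_on with
    | _ g => exact congrArg Submodule.Quotient.mk (Preadditive.add_comp _ _ _ f f' g)
  comp_add X Y Z f g g' := by
    induction f using Submodule.Quotient.induction_on with
    | _ f =>
    induction g using Submodule.Quotient.induction_on with
    | _ g =>
    induction g' using Submodule.Quotient.induction_on with
    | _ g' => exact congrArg Submodule.Quotient.mk (Preadditive.comp_add _ _ _ f g g')

instance : Linear k (QuotCat I) where
  homModule X Y := inferInstanceAs (Module k ((X.as ⟶ Y.as) ⧸ I.hom X.as Y.as))
  smul_comp X Y Z c f g := by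
    induction f using Submodule.Quotient.induction_on with
    | _ f =>
    induction g using Submodule.Quotient.induction_on with
    | _ g => exact congrArg Submodule.Quotient.mk (Linear.smul_comp _ _ _ c f g)
  comp_smul X Y Z f c g := by
    induction f using Submodule.Quotient.induction_on with
    | _ f =>
    induction g using Submodule.Quotient.induction_on with
    | _ g => exact congrArg Submodule.Quotient.mk (Linear.comp_smul _ _ _ f c g)

end QuotCat

end Quotient

/-! ## Trivial extensions -/

section TrivialExtension

variable (k : Type w) [Field k] (C : Type u) [Category.{v} C] [Preadditive C] [Linear k C]

/-- The trivial extension `C ⋉ C^*` of a `k`-linear category by its restricted dual bimodule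
`C^*`, which is `⨁_{x,y} Hom_k (e_y C e_x, k)`.  Here `e_y C^* e_x` is the dual of
`e_x C e_y`, with `(a φ b) (h) = φ (b h a)`, and the product of two elements of `C^*` is zero. -/
structure TrivExt (k : Type w) (C : Type u) where
  /-- the underlying object -/
  as : C

namespace TrivExt

instance : Category.{max v w} (TrivExt k C) where
  Hom X Y := (X.as ⟶ Y.as) × Module.Dual k (Y.as ⟶ X.as)
  id X := (𝟙 X.as, 0)
  comp {X Y Z} f g :=
    (f.1 ≫ g.1, g.2 ∘ₗ Linear.rightComp k Z.as f.1 + f.2 ∘ₗ Linear.leftComp k X.as g.1)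
  id_comp f := by
    refine Prod.ext (Category.id_comp f.1) (LinearMap.ext fun h => ?_)
    simp
  comp_id f := by
    refine Prod.ext (Category.comp_id f.1) (LinearMap.ext fun h => ?_)
    simp
  assoc f g h := by
    refine Prod.ext (Category.assoc f.1 g.1 h.1) (LinearMap.ext fun h => ?_)
    simp [add_assoc]

variable {k C}

@[simp]
theorem comp_fst {X Y Z : TrivExt k C} (f : X ⟶ Y) (g : Y ⟶ Z) : (f ≫ g).1 = f.1 ≫ g.1 := rfl

theorem comp_snd_apply {X Y Z : TrivExt k C} (f : X ⟶ Y) (g : Y ⟶ Z) (h : Z.as ⟶ X.as) :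
    (f ≫ g).2 h = g.2 (h ≫ f.1) + f.2 (g.1 ≫ h) := rfl

instance : Preadditive (TrivExt k C) where
  homGroup X Y :=
    inferInstanceAs (AddCommGroup ((X.as ⟶ Y.as) × Module.Dual k (Y.as ⟶ X.as)))
  add_comp X Y Z f f' g := by
    refine Prod.ext (Preadditive.add_comp _ _ _ f.1 f'.1 g.1) (LinearMap.ext fun h => ?_)
    change g.2 (h ≫ (f.1 + f'.1)) + (f.2 (g.1 ≫ h) + f'.2 (g.1 ≫ h)) =
      (g.2 (h ≫ f.1) + f.2 (g.1 ≫ h)) + (g.2 (h ≫ f'.1) + f'.2 (g.1 ≫ h))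
    rw [Preadditive.comp_add, map_add]
    abel
  comp_add X Y Z f g g' := by
    refine Prod.ext (Preadditive.comp_add _ _ _ f.1 g.1 g'.1) (LinearMap.ext fun h => ?_)
    change (g.2 (h ≫ f.1) + g'.2 (h ≫ f.1)) + f.2 ((g.1 + g'.1) ≫ h) =
      (g.2 (h ≫ f.1) + f.2 (g.1 ≫ h)) + (g'.2 (h ≫ f.1) + f.2 (g'.1 ≫ h))
    rw [Preadditive.add_comp, map_add]
    abel

instance : Linear k (TrivExt k C) where
  homModule X Y :=
    inferInstanceAs (Module k ((X.as ⟶ Y.as) × Module.Dual k (Y.as ⟶ X.as)))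
  smul_comp X Y Z c f g := by
    refine Prod.ext (Linear.smul_comp _ _ _ c f.1 g.1) (LinearMap.ext fun h => ?_)
    change g.2 (h ≫ (c • f.1)) + c • f.2 (g.1 ≫ h) = c • (g.2 (h ≫ f.1) + f.2 (g.1 ≫ h))
    rw [Linear.comp_smul, map_smul, smul_add]
  comp_smul X Y Z f c g := by
    refine Prod.ext (Linear.comp_smul _ _ _ f.1 c g.1) (LinearMap.ext fun h => ?_)
    change c • g.2 (h ≫ f.1) + f.2 ((c • g.1) ≫ h) = c • (g.2 (h ≫ f.1) + f.2 (g.1 ≫ h))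
    rw [Linear.smul_comp, map_smul, smul_add]

variable (k C)

/-- The projection `C ⋉ C^* ⟶ C` with kernel `C^*`.  Composing with it turns a left `C`-module
into a left module over the trivial extension. -/
def proj : TrivExt k C ⥤ C where
  obj X := X.as
  map f := f.1

end TrivExt

end TrivialExtension

/-! ## The envelope `𝔅 / ℑ` -/

section Envelope

variable {k : Type w} [Field k] {A : Type u} [Category.{v} A] [Preadditive A] [Linear k A]

/-- The category `𝔅` for the filtration `A = J ^ 0 ⊇ J ^ 1 ⊇ J ^ 2 ⊇ …` of `A` by the powers of
an ideal `J`.  Its objects are the `x[i]` with `x` an object of `A` and `i ∈ ℤ`; the space of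
morphisms `x[i] ⟶ y[j]` is `A(x, y)` if `i ≥ j`, and `J ^ (j - i) (x, y)` otherwise. -/
@[ext]
structure Shifted (J : HomIdeal k A) where
  /-- the object `x` of `x[i]` -/
  obj : A
  /-- the integer `i` of `x[i]` -/
  deg : ℤ

namespace Shifted

variable (J : HomIdeal k A)

/-- `(j - i).toNat` is `j - i` if `j > i` and is `0` if `i ≥ j`. -/
instance : Category.{v} (Shifted J) where
  Hom X Y := (J.pow (Y.deg - X.deg).toNat).hom X.obj Y.obj
  id X := ⟨𝟙 X.obj, by rw [sub_self]; exact Submodule.mem_top⟩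
  comp f g := ⟨f.1 ≫ g.1, J.comp_mem_pow (by omega) f.2 g.2⟩
  id_comp f := Subtype.ext (Category.id_comp f.1)
  comp_id f := Subtype.ext (Category.comp_id f.1)
  assoc f g h := Subtype.ext (Category.assoc f.1 g.1 h.1)

instance : Preadditive (Shifted J) where
  homGroup X Y :=
    inferInstanceAs (AddCommGroup ((J.pow (Y.deg - X.deg).toNat).hom X.obj Y.obj))
  add_comp _ _ _ f f' g := Subtype.ext (Preadditive.add_comp _ _ _ f.1 f'.1 g.1)
  comp_add _ _ _ f g g' := Subtype.ext (Preadditive.comp_add _ _ _ f.1 g.1 g'.1)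

instance : Linear k (Shifted J) where
  homModule X Y :=
    inferInstanceAs (Module k ((J.pow (Y.deg - X.deg).toNat).hom X.obj Y.obj))
  smul_comp _ _ _ c f g := Subtype.ext (Linear.smul_comp _ _ _ c f.1 g.1)
  comp_smul _ _ _ f c g := Subtype.ext (Linear.comp_smul _ _ _ f.1 c g.1)

/-- The ideal `ℑ` of `𝔅`.  For `J ^ N = 0`, its morphisms `x[i] ⟶ y[j]` are
`J ^ (N - (i - j)) (x, y)` if `i - N < j < i`, all of `𝔅(x[i], y[j])` if `j ≤ i - N`, and `0`
if `j ≥ i`: all three cases are `J ^ (max (N - (i - j)) 0)`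
(see `cutIdeal_mid`, `cutIdeal_low` and `cutIdeal_high`). -/
def cutIdeal (N : ℕ) : HomIdeal k (Shifted J) where
  hom X Y := ((J.pow (N + (Y.deg - X.deg)).toNat).hom X.obj Y.obj).comap
    ((J.pow (Y.deg - X.deg).toNat).hom X.obj Y.obj).subtype
  comp_left a _ hf := J.comp_mem_pow (by omega) a.2 hf
  comp_right b hf := J.comp_mem_pow (by omega) hf b.2

theorem cutIdeal_mid (N : ℕ) {X Y : Shifted J} {m : ℕ} (hm : (m : ℤ) = N - (X.deg - Y.deg))
    (f : X ⟶ Y) :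
    f ∈ (cutIdeal J N).hom X Y ↔ f.1 ∈ (J.pow m).hom X.obj Y.obj := by
  have h : (N + (Y.deg - X.deg)).toNat = m := by omega
  rw [← h]; rfl

theorem cutIdeal_low (N : ℕ) {X Y : Shifted J} (h : Y.deg ≤ X.deg - N) :
    (cutIdeal J N).hom X Y = ⊤ := by
  have h : (N + (Y.deg - X.deg)).toNat = 0 := by omega
  refine (Submodule.eq_top_iff').2 fun f => ?_
  change f.1 ∈ (J.pow (N + (Y.deg - X.deg)).toNat).hom X.obj Y.obj
  rw [h]; exact Submodule.mem_top

theorem cutIdeal_high (N : ℕ) (hN : J.pow N = ⊥) {X Y : Shifted J} (h : X.deg ≤ Y.deg) :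
    (cutIdeal J N).hom X Y = ⊥ := by
  refine (Submodule.eq_bot_iff _).2 fun f hf => Subtype.ext ?_
  have h2 := J.pow_anti (show N ≤ (N + (Y.deg - X.deg)).toNat by omega) _ _ hf
  rw [hN] at h2
  exact (Submodule.mem_bot k).1 h2

end Shifted

/-- The category `ℭ(A) = 𝔅 / ℑ` for the filtration by the powers of a nilpotent ideal `J`, with
`N` the nilpotency degree of `J`. -/
abbrev Envelope (J : HomIdeal k A) : Type u :=
  QuotCat (Shifted.cutIdeal J J.nilpotencyDegree)

end Envelope

/-! ## Left modules, standard modules and quasi-hereditary algebras -/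

section Modules

variable (k : Type w) [Field k] {C : Type u} [Category.{v} C] [Preadditive C] [Linear k C]

/-- The subspace at `y` of the trace in `P(x) = C e_x` of all `P(z)` with `z > x`: it is spanned
by the morphisms `x ⟶ y` that factor through some `z > x`. -/
def traceSub (lt : C → C → Prop) (x y : C) : Submodule k (x ⟶ y) :=
  Submodule.span k {f | ∃ (z : C) (a : x ⟶ z) (b : z ⟶ y), lt x z ∧ f = a ≫ b}

variable {k} in
theorem traceSub_comp (lt : C → C → Prop) {x y z : C} {f : x ⟶ y} (hf : f ∈ traceSub k lt x y)
    (b : y ⟶ z) : f ≫ b ∈ traceSub k lt x z := by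
  induction hf using Submodule.span_induction with
  | mem f h =>
    obtain ⟨t, c, d, ht, rfl⟩ := h
    exact Submodule.subset_span ⟨t, c, d ≫ b, ht, by simp⟩
  | zero => simp
  | add f g _ _ hf hg => rw [Preadditive.add_comp]; exact add_mem hf hg
  | smul c f _ hf => rw [Linear.smul_comp]; exact Submodule.smul_mem _ c hf

/-- The trace, in the left projective module `P(x) = C e_x`, of all `P(z)` with `z > x`, as a
left `C`-module. -/
def traceModule (lt : C → C → Prop) (x : C) : C ⥤ ModuleCat.{v} k where
  obj y := ModuleCat.of k (traceSub k lt x y)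
  map {y z} b := ModuleCat.ofHom
    ((Linear.rightComp k x b).restrict fun _ hf => traceSub_comp lt hf b)
  map_id y := by
    ext f
    exact Category.comp_id f.1
  map_comp a b := by
    ext f
    exact (Category.assoc f.1 a b).symm

/-- The left standard module `Δ(x)`: the quotient of the left projective `P(x) = C e_x` by the
trace of all `P(z)` with `z > x`. -/
def standardModule (lt : C → C → Prop) (x : C) : C ⥤ ModuleCat.{v} k where
  obj y := ModuleCat.of k ((x ⟶ y) ⧸ traceSub k lt x y)
  map {y z} b := ModuleCat.ofHom
    (Submodule.mapQ _ _ (Linear.rightComp k x b) fun _ hf => traceSub_comp lt hf b)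
  map_id y := by
    ext f
    exact congrArg Submodule.Quotient.mk (Category.comp_id _)
  map_comp a b := by
    ext f
    exact congrArg Submodule.Quotient.mk (Category.assoc _ a b).symm

variable {k} in
/-- `M` has a finite filtration all of whose subquotients belong to the class `S`. -/
inductive HasFiltration (S : (C ⥤ ModuleCat.{v} k) → Prop) : (C ⥤ ModuleCat.{v} k) → Prop
  | zero (M : C ⥤ ModuleCat.{v} k) (hM : Limits.IsZero M) : HasFiltration S M
  | extend (E : ShortComplex (C ⥤ ModuleCat.{v} k)) (hE : E.ShortExact)
      (h₁ : HasFiltration S E.X₁) (h₃ : S E.X₃) : HasFiltration S E.X₂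

variable (C)

/-- `C` is a basic `k`-linear category with finite-dimensional projectives and injectives. -/
structure IsBasicAlgebra : Prop where
  local_end : ∀ x : C, IsLocalRing (End x)
  eq_of_iso : ∀ x y : C, Nonempty (x ≅ y) → x = y
  finite_hom : ∀ x y : C, Module.Finite k (x ⟶ y)
  finite_proj : ∀ x : C, {y : C | Nontrivial (x ⟶ y)}.Finite
  finite_inj : ∀ y : C, {x : C | Nontrivial (x ⟶ y)}.Finite

/-- `C` is symmetric: there is a trace form `t` such that `(a, b) ↦ t (a b)` is a symmetric
(automatically associative) non-degenerate bilinear form. -/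
def IsSymmetric : Prop :=
  ∃ t : ∀ x : C, (x ⟶ x) →ₗ[k] k,
    (∀ (x y : C) (f : x ⟶ y) (g : y ⟶ x), t x (f ≫ g) = t y (g ≫ f)) ∧
    ∀ (x y : C) (f : x ⟶ y), (∀ g : y ⟶ x, t x (f ≫ g) = 0) → f = 0

/-- `C` is quasi-hereditary with respect to the strict partial order `lt` on its objects (which
index the simple modules): the order is interval-finite; each standard module `Δ(x)` contains
the simple module `L(x)` with multiplicity one and all its other composition factors are `L(y)`
with `y < x`; and the kernel of `P(x) ⟶ Δ(x)`, i.e. the trace, has a finite filtration with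
subquotients `Δ(z)`, `z > x`.  (The value at `y` of a module over a basic category is nonzero iff
`L(y)` is a composition factor, and over an algebraically closed field its dimension is the
multiplicity of `L(y)`.) -/
structure IsQuasiHereditary (lt : C → C → Prop) : Prop where
  basic : IsBasicAlgebra k C
  order : IsStrictOrder C lt
  interval_finite : ∀ x y : C, {z : C | lt x z ∧ lt z y}.Finite
  standard_self : ∀ x : C, Module.finrank k ((standardModule k lt x).obj x) = 1
  standard_lt : ∀ x y : C, Nontrivial ((standardModule k lt x).obj y) → y = x ∨ lt y x
  filtration : ∀ x : C, HasFiltration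
    (fun M => ∃ z : C, lt x z ∧ Nonempty (M ≅ standardModule k lt z)) (traceModule k lt x)

end Modules

/-! ## Quivers with relations and the algebra `Ã` -/

section Quiver

variable {k : Type w} [Field k] {V : Type u} [Quiver.{v} V]

/-- The two-sided ideal of the path algebra (the free `k`-linear category on the paths of the
quiver) generated by a family `R` of sets of linear combinations of parallel paths. -/
noncomputable def relIdeal (R : ∀ x y : V, Set (Quiver.Path x y →₀ k)) :
    HomIdeal k (Free k (Paths V)) :=
  HomIdeal.span fun x y => R x y

variable (k V) in
/-- The arrow ideal of the path algebra. -/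
noncomputable def arrowIdeal : HomIdeal k (Free k (Paths V)) :=
  relIdeal fun x y => Set.range fun a : x ⟶ y => Finsupp.single a.toPath (1 : k)

/-- The relations `R` generate an admissible ideal: it lies in the square of the arrow ideal, and
it contains some power of the arrow ideal. -/
def IsAdmissible (R : ∀ x y : V, Set (Quiver.Path x y →₀ k)) : Prop :=
  relIdeal R ≤ (arrowIdeal k V).pow 2 ∧ ∃ m : ℕ, (arrowIdeal k V).pow m ≤ relIdeal R

/-- The algebra given by a quiver and relations, as a `k`-linear category: the path algebra modulo
the ideal generated by the relations. -/
abbrev QuiverAlgebra (R : ∀ x y : V, Set (Quiver.Path x y →₀ k)) : Type u := QuotCat (relIdeal R)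

variable (V) in
/-- The vertices of the extended quiver: the old vertices `x` and a new vertex `x̃` for each
old vertex `x`. -/
inductive TildeVertex : Type u
  | old (x : V) : TildeVertex
  | new (x : V) : TildeVertex

/-- The arrows of the extended quiver: the old ones, and one new arrow `x ⟶ x̃` for each old
vertex `x`. -/
inductive TildeArrow : TildeVertex V → TildeVertex V → Type (max u v)
  | old {x y : V} (a : x ⟶ y) : TildeArrow (.old x) (.old y)
  | new (x : V) : TildeArrow (.old x) (.new x)

instance : Quiver.{max u v} (TildeVertex V) := ⟨TildeArrow⟩

variable (V) in
/-- The inclusion of the old quiver in the extended one. -/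
def tildeInclusion : V ⥤q TildeVertex V where
  obj x := .old x
  map a := TildeArrow.old a

/-- The old relations, regarded as relations for the extended quiver. -/
def tildeRel (R : ∀ x y : V, Set (Quiver.Path x y →₀ k)) :
    ∀ x y : TildeVertex V, Set (Quiver.Path x y →₀ k)
  | .old x, .old y => Finsupp.mapDomain (fun p => (tildeInclusion V).mapPath p) '' R x y
  | _, _ => ∅

/-- The algebra `Ã`: attach to the quiver of `A` a new vertex `x̃` and an arrow `x ⟶ x̃` for each
vertex `x`, and keep the relations of `A`. -/
abbrev TildeAlgebra (R : ∀ x y : V, Set (Quiver.Path x y →₀ k)) : Type u :=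
  QuiverAlgebra (tildeRel R)

/-- The algebra `ℭ(Ã)`, for the radical filtration of `Ã`. -/
abbrev TildeC (R : ∀ x y : V, Set (Quiver.Path x y →₀ k)) : Type u :=
  Envelope (radical k (TildeAlgebra R))

/-- The algebra `𝔇(Ã)`, the trivial extension of `ℭ(Ã)` by its restricted dual bimodule. -/
abbrev TildeD (R : ∀ x y : V, Set (Quiver.Path x y →₀ k)) : Type u := TrivExt k (TildeC R)

/-- The vertex `l ∈ N ∪ Ñ` of the object `(l, j)` of `ℭ(Ã)`. -/
def TildeC.vertex {R : ∀ x y : V, Set (Quiver.Path x y →₀ k)} (X : TildeC R) : TildeVertex V :=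
  X.as.obj.as

/-- The integer `j` of the object `(l, j)` of `ℭ(Ã)`. -/
def TildeC.deg {R : ∀ x y : V, Set (Quiver.Path x y →₀ k)} (X : TildeC R) : ℤ := X.as.deg

/-- The extended first order on the objects of `ℭ(Ã)`: `(l, j) < (k, i)` if `j < i`, or if `j = i`,
`l` is a new vertex and `k` is an old one. -/
def firstLT (R : ∀ x y : V, Set (Quiver.Path x y →₀ k)) (X Y : TildeC R) : Prop :=
  X.deg < Y.deg ∨
    (X.deg = Y.deg ∧ (∃ l : V, X.vertex = .new l) ∧ ∃ m : V, Y.vertex = .old m)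

/-- The same order on the objects of `𝔇(Ã)`, which are those of `ℭ(Ã)`. -/
def firstLTD (R : ∀ x y : V, Set (Quiver.Path x y →₀ k)) (X Y : TildeD R) : Prop :=
  firstLT R X.as Y.as

end Quiver

end QHEnvelope

/-! Write J for the radical of Ã and fix X = (x, i). The morphism spaces of ℭ are filtered by
layers, the images of the powers of J. In the projective of ℭ at X the trace is exactly layer 1
(`IsSplitRadical.traceSub_eq`), because an element of J already defines a morphism into degree i +
1. Hence Δ(z, l) is one-dimensional at (z, j) for l - N < j ≤ l and zero elsewhere.

In 𝔇 the projective P(X) has the chain 0 = `sndSub 0` ≤ … ≤ `sndSub N` = ℭ^* = `fstSub N` ≤ … ≤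
`fstSub 1`. A basis of J^m/J^(m+1) (x, z) generates `fstSub m` modulo `fstSub (m + 1)` in degree l =
i + m; a basis dual to one of J^m/J^(m+1) (z, x) generates `sndSub (m + 1)` modulo `sndSub m` in
degree l = i - m + N - 1. The only relations are the traces, so each subquotient is a direct sum of
modules Δ(z, l), one for each basis vector (`hasFiltration_fstSub_pred`,
`hasFiltration_sndSub_succ`).

For m ≥ 1 in the first family and m < N - 1 in the second, l > i. The critical case is m = N - 1 in
the second family, where l = i and the order must be decided by the vertices: J^(N-1) (z, x) ≠ 0 has
to force x to be new and z to be old. This is what the new arrows achieve. Composition with y → ỹ is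
injective and goes one power of J deeper, so nothing nonzero in J^(N-1) ends at an old vertex; and
new vertices are sinks.

Consequently ℭ^* lies in the trace, the trace in 𝔇 is `fstSub 1`, and the standard modules of 𝔇 and
ℭ coincide. Symmetry holds for every trivial extension: evaluate the dual component at the identity.
-/

namespace QHEnvelope

/-! ### Filtrations of submodules of projectives by standard modules -/

section Filtrations

/-- A short complex of functors with values in modules is short exact if it is so at every
object. -/
theorem shortExact_of_evaluation {k : Type w} [Field k] {C : Type u} [Category.{v} C]
    (E : ShortComplex (C ⥤ ModuleCat.{v} k))
    (hf : ∀ Y, Function.Injective (E.f.app Y).hom)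
    (hg : ∀ Y, Function.Surjective (E.g.app Y).hom)
    (hfg : ∀ Y, Function.Exact (E.f.app Y).hom (E.g.app Y).hom) : E.ShortExact := by
  have : ∀ Y, Mono (E.f.app Y) := fun Y => (ModuleCat.mono_iff_injective _).2 (hf Y)
  have : ∀ Y, Epi (E.g.app Y) := fun Y => (ModuleCat.epi_iff_surjective _).2 (hg Y)
  refine { exact := ?_, mono_f := NatTrans.mono_of_mono_app _, epi_g := NatTrans.epi_of_epi_app _ }
  rw [ShortComplex.exact_iff_isZero_homology, Functor.isZero_iff]
  intro Y
  refine Limits.IsZero.of_iso ?_ (E.mapHomologyIso ((evaluation _ _).obj Y)).symm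
  rw [← ShortComplex.exact_iff_isZero_homology]
  exact (ShortComplex.ShortExact.moduleCat_exact_iff_function_exact _).2 (hfg Y)

variable {k : Type w} [Field k] {C : Type u} [Category.{v} C] [Preadditive C] [Linear k C]

variable (k) in
/-- A submodule of the left projective module `P(X) = C e_X`. -/
@[ext]
structure SubProj (X : C) where
  /-- the component at `Y` -/
  hom : ∀ Y : C, Submodule k (X ⟶ Y)
  /-- stability under postcomposition -/
  comp : ∀ {Y Z : C} {f : X ⟶ Y} (b : Y ⟶ Z), f ∈ hom Y → f ≫ b ∈ hom Z

namespace SubProj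

variable {X : C}

/-- A submodule of `P(X)` as a left module. -/
def toFunctor (U : SubProj k X) : C ⥤ ModuleCat.{v} k where
  obj Y := ModuleCat.of k (U.hom Y)
  map {_ _} b := ModuleCat.ofHom ((Linear.rightComp k X b).restrict fun _ hf => U.comp b hf)
  map_id Y := by
    ext f
    exact Category.comp_id f.1
  map_comp a b := by
    ext f
    exact (Category.assoc f.1 a b).symm

/-- The quotient of two submodules of `P(X)`. -/
def quotient (U W : SubProj k X) : C ⥤ ModuleCat.{v} k where
  obj Y := ModuleCat.of k (W.hom Y ⧸ (U.hom Y).comap (W.hom Y).subtype)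
  map {_ _} b := ModuleCat.ofHom
    (Submodule.mapQ _ _ ((Linear.rightComp k X b).restrict fun _ hf => W.comp b hf)
      fun _ hf => U.comp b hf)
  map_id Y := by
    ext f
    exact congrArg Submodule.Quotient.mk (Subtype.ext (Category.comp_id f.1))
  map_comp a b := by
    ext f
    exact congrArg Submodule.Quotient.mk (Subtype.ext (Category.assoc f.1 a b).symm)

/-- The short complex `0 ⟶ U ⟶ W ⟶ W / U ⟶ 0`. -/
def shortComplex (U W : SubProj k X) (h : ∀ Y, U.hom Y ≤ W.hom Y) :
    ShortComplex (C ⥤ ModuleCat.{v} k) where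
  X₁ := U.toFunctor
  X₂ := W.toFunctor
  X₃ := U.quotient W
  f := { app := fun Y => ModuleCat.ofHom (Submodule.inclusion (h Y)) }
  g := { app := fun Y => ModuleCat.ofHom (Submodule.mkQ _) }
  zero := by
    ext Y f
    exact (Submodule.Quotient.mk_eq_zero _).2 f.2

theorem shortComplex_shortExact (U W : SubProj k X) (h : ∀ Y, U.hom Y ≤ W.hom Y) :
    (shortComplex U W h).ShortExact := by
  refine shortExact_of_evaluation _ (fun Y => Submodule.inclusion_injective (h Y))
    (fun Y => Submodule.mkQ_surjective _) (fun Y f => ?_)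
  refine (Submodule.Quotient.mk_eq_zero _).trans ⟨fun hf => ⟨⟨f.1, hf⟩, rfl⟩, ?_⟩
  rintro ⟨g, rfl⟩
  exact g.2

/-- If `W = U + C w` and the annihilator of `w` modulo `U` is the trace, then `W / U` is a
standard module. -/
theorem nonempty_quotient_iso (lt : C → C → Prop) (U W : SubProj k X) {Z : C} (a : X ⟶ Z)
    (ha : a ∈ W.hom Z) (hW : ∀ Y, ∀ f ∈ W.hom Y, ∃ d : Z ⟶ Y, f - a ≫ d ∈ U.hom Y)
    (hU : ∀ Y (d : Z ⟶ Y), a ≫ d ∈ U.hom Y ↔ d ∈ traceSub k lt Z Y) :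
    Nonempty (U.quotient W ≅ standardModule k lt Z) := by
  let φ : ∀ Y, (Z ⟶ Y) →ₗ[k] (W.hom Y ⧸ (U.hom Y).comap (W.hom Y).subtype) := fun Y =>
    (Submodule.mkQ _) ∘ₗ ((Linear.leftComp k Y a).codRestrict (W.hom Y) fun d => W.comp d ha)
  have hφ : ∀ Y, traceSub k lt Z Y = LinearMap.ker (φ Y) := by
    intro Y
    ext d
    rw [← hU]
    exact (Submodule.Quotient.mk_eq_zero ((U.hom Y).comap (W.hom Y).subtype)
      (x := ⟨a ≫ d, W.comp d ha⟩)).symm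
  have hs : ∀ Y, Function.Surjective (φ Y) := by
    intro Y f
    induction f using Submodule.Quotient.induction_on with
    | _ f =>
      obtain ⟨d, hd⟩ := hW Y f.1 f.2
      refine ⟨d, ((Submodule.Quotient.eq ((U.hom Y).comap (W.hom Y).subtype)
        (x := f) (y := ⟨a ≫ d, W.comp d ha⟩)).2 hd).symm⟩
  let e : ∀ Y, ((Z ⟶ Y) ⧸ traceSub k lt Z Y) ≃ₗ[k]
      (W.hom Y ⧸ (U.hom Y).comap (W.hom Y).subtype) := fun Y =>
    (Submodule.quotEquivOfEq _ _ (hφ Y)).trans ((φ Y).quotKerEquivOfSurjective (hs Y))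
  refine ⟨(NatIso.ofComponents (fun Y => (e Y).toModuleIso) ?_ :
    standardModule k lt Z ≅ U.quotient W).symm⟩
  intro Y Y' b
  ext d
  induction d using Submodule.Quotient.induction_on with
  | _ d =>
  exact congrArg (Submodule.Quotient.mk (p := (U.hom Y').comap (W.hom Y').subtype))
    (Subtype.ext (Category.assoc a d b).symm :
      (⟨a ≫ d ≫ b, W.comp _ ha⟩ : W.hom Y') = ⟨(a ≫ d) ≫ b, W.comp b (W.comp d ha)⟩)

/-- A generator whose annihilator modulo `U` is the trace contributes exactly one standard module on
top of a filtration of `U`. -/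
theorem hasFiltration_of_generator {lt : C → C → Prop} {U W : SubProj k X}
    (h : ∀ Y, U.hom Y ≤ W.hom Y) {Z : C} (hZ : lt X Z) (a : X ⟶ Z)
    (ha : a ∈ W.hom Z) (hW : ∀ Y, ∀ f ∈ W.hom Y, ∃ d : Z ⟶ Y, f - a ≫ d ∈ U.hom Y)
    (hU : ∀ Y (d : Z ⟶ Y), a ≫ d ∈ U.hom Y ↔ d ∈ traceSub k lt Z Y)
    (hF : HasFiltration (fun M => ∃ z : C, lt X z ∧ Nonempty (M ≅ standardModule k lt z))
      U.toFunctor) :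
    HasFiltration (fun M => ∃ z : C, lt X z ∧ Nonempty (M ≅ standardModule k lt z))
      W.toFunctor :=
  HasFiltration.extend (shortComplex U W h) (shortComplex_shortExact U W h) hF
    ⟨Z, hZ, nonempty_quotient_iso lt U W a ha hW hU⟩

/-- The submodule generated by `U` and finitely many elements `a s`, `s ∈ T`. -/
def adjoin {ι : Type*} (U : SubProj k X) {Z : ι → C} (a : ∀ s, X ⟶ Z s) (T : Finset ι) :
    SubProj k X where
  hom Y :=
    { carrier := {f | ∃ d : ∀ s, Z s ⟶ Y, f - ∑ s ∈ T, a s ≫ d s ∈ U.hom Y}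
      zero_mem' := ⟨0, by simp⟩
      add_mem' := by
        rintro f g ⟨d, hd⟩ ⟨e, he⟩
        refine ⟨d + e, ?_⟩
        have := add_mem hd he
        simp only [Pi.add_apply, Preadditive.comp_add, Finset.sum_add_distrib]
        convert this using 1
        abel
      smul_mem' := by
        rintro c f ⟨d, hd⟩
        refine ⟨c • d, ?_⟩
        have := Submodule.smul_mem _ c hd
        simpa only [Pi.smul_apply, Linear.comp_smul, ← Finset.smul_sum, ← smul_sub] using this }
  comp {Y Z'} f b := by
    rintro ⟨d, hd⟩
    refine ⟨fun s => d s ≫ b, ?_⟩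
    have := U.comp b hd
    simpa only [Preadditive.sub_comp, Preadditive.sum_comp, Category.assoc] using this

theorem le_adjoin {ι : Type*} (U : SubProj k X) {Z : ι → C} (a : ∀ s, X ⟶ Z s) (T : Finset ι)
    (Y : C) : U.hom Y ≤ (U.adjoin a T).hom Y := fun _ hf => ⟨0, by simpa using hf⟩

theorem comp_mem_adjoin {ι : Type*} (U : SubProj k X) {Z : ι → C} (a : ∀ s, X ⟶ Z s)
    {T : Finset ι} {s : ι} (hs : s ∈ T) {Y : C} (d : Z s ⟶ Y) :
    a s ≫ d ∈ (U.adjoin a T).hom Y := by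
  classical
  -- The coefficients are the identity in position `s` and zero elsewhere; since the object `Z t`
  -- varies with `t`, the identity has to be transported by `eqToHom`.
  refine (U.adjoin a T).comp d ⟨fun t => if h : s = t then eqToHom (by rw [h]) else 0, ?_⟩
  rw [Finset.sum_eq_single s]
  · simp
  · intro t _ ht
    beta_reduce; rw [dif_neg ht.symm, Limits.comp_zero]
  · exact fun h => absurd hs h

/-- If `W / U` is generated by elements `a s`, and the only relations between them are those
coming from the traces, so that `W / U` is a finite direct sum of standard modules, then a
filtration of `U` extends to one of `W`. -/
theorem hasFiltration_of_generators {lt : C → C → Prop} {U W : SubProj k X}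
    {ι : Type*} [Fintype ι] {Z : ι → C} (hZ : ∀ s, lt X (Z s)) (a : ∀ s, X ⟶ Z s)
    (hUW : ∀ Y, U.hom Y ≤ W.hom Y) (ha : ∀ s, a s ∈ W.hom (Z s))
    (hW : ∀ Y, W.hom Y ≤ (U.adjoin a Finset.univ).hom Y)
    (hU : ∀ Y s, ∀ d ∈ traceSub k lt (Z s) Y, a s ≫ d ∈ U.hom Y)
    (hU' : ∀ Y (d : ∀ s, Z s ⟶ Y), ∑ s, a s ≫ d s ∈ U.hom Y →
      ∀ s, d s ∈ traceSub k lt (Z s) Y)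
    (hF : HasFiltration (fun M => ∃ z : C, lt X z ∧ Nonempty (M ≅ standardModule k lt z))
      U.toFunctor) :
    HasFiltration (fun M => ∃ z : C, lt X z ∧ Nonempty (M ≅ standardModule k lt z))
      W.toFunctor := by
  classical
  -- The generators are adjoined one at a time: their independence modulo the traces makes each
  -- successive annihilator a trace, so no direct sum has to be formed.
  have key : ∀ T : Finset ι, HasFiltration
      (fun M => ∃ z : C, lt X z ∧ Nonempty (M ≅ standardModule k lt z))
      (U.adjoin a T).toFunctor := by
    intro T
    induction T using Finset.induction_on with
    | empty =>
      have h : U.adjoin a ∅ = U := by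
        ext Y f
        exact ⟨fun ⟨d, hd⟩ => by simpa using hd, fun hf => ⟨0, by simpa using hf⟩⟩
      rwa [h]
    | insert s T hs ih =>
      have hsum : ∀ {Y : C} (d : ∀ s, Z s ⟶ Y) (e : Z s ⟶ Y),
          ∑ t ∈ T, a t ≫ Function.update d s e t = ∑ t ∈ T, a t ≫ d t := by
        intro Y d e
        refine Finset.sum_congr rfl fun t ht => ?_
        rw [Function.update_of_ne]
        rintro rfl
        exact hs ht
      refine hasFiltration_of_generator ?_ (hZ s) (a s) ?_ ?_ ?_ ih
      · rintro Y f ⟨d, hd⟩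
        refine ⟨Function.update d s 0, ?_⟩
        rw [Finset.sum_insert hs, hsum]
        simpa using hd
      · refine ⟨Function.update 0 s (𝟙 _), ?_⟩
        rw [Finset.sum_insert hs, hsum]
        simp
      · rintro Y f ⟨d, hd⟩
        refine ⟨d s, d, ?_⟩
        rwa [Finset.sum_insert hs, ← sub_sub] at hd
      · intro Y d
        refine ⟨?_, fun hd => ⟨0, by simpa using hU Y s d hd⟩⟩
        rintro ⟨e, he⟩
        -- Moving the combination of the generators in `T` to the left of `he` gives one relation
        -- over the whole index set: `d` at `s`, `-e` on `T`, zero elsewhere.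
        have h := hU' Y (Function.update (fun t => if t ∈ T then - e t else 0) s d) ?_ s
        · simpa using h
        · rw [← Finset.sum_subset (Finset.subset_univ (insert s T)), Finset.sum_insert hs, hsum,
            Finset.sum_congr rfl fun t ht => by rw [if_pos ht, Preadditive.comp_neg],
            Finset.sum_neg_distrib, Function.update_self, ← sub_eq_add_neg]
          · exact he
          · intro t _ ht
            rw [Finset.mem_insert, not_or] at ht
            rw [Function.update_of_ne ht.1, if_neg ht.2, Limits.comp_zero]
  have h : W = U.adjoin a Finset.univ := by
    ext Y f
    refine ⟨fun hf => hW Y hf, ?_⟩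
    rintro ⟨d, hd⟩
    have := add_mem (hUW Y hd) (sum_mem fun s (_ : s ∈ Finset.univ) => W.comp (d s) (ha s))
    simpa using this
  rw [h]
  exact key _

/-- A version of `hasFiltration_of_generators` for generators that are grouped by a type `β`, such
that for each `Y` only the generators in one of the groups matter modulo the traces. -/
theorem hasFiltration_of_grouped_generators {lt : C → C → Prop} {U W : SubProj k X}
    {β : Type*} [Fintype β] {n : β → ℕ} {Z : β → C} (vertex : C → β)
    (a : ∀ z, Fin (n z) → (X ⟶ Z z)) (hZ : ∀ z, Fin (n z) → lt X (Z z))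
    (hUW : ∀ Y, U.hom Y ≤ W.hom Y) (ha : ∀ z s, a z s ∈ W.hom (Z z))
    (hW : ∀ Y, W.hom Y ≤ (U.adjoin (Z := fun p : Σ z, Fin (n z) => Z p.1)
      (fun p => a p.1 p.2) Finset.univ).hom Y)
    (hU : ∀ Y z s, ∀ d ∈ traceSub k lt (Z z) Y, a z s ≫ d ∈ U.hom Y)
    (hne : ∀ Y z, z ≠ vertex Y → ∀ d : Z z ⟶ Y, d ∈ traceSub k lt (Z z) Y)
    (hU' : ∀ Y (d : Fin (n (vertex Y)) → (Z (vertex Y) ⟶ Y)),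
      ∑ s, a (vertex Y) s ≫ d s ∈ U.hom Y → ∀ s, d s ∈ traceSub k lt (Z (vertex Y)) Y)
    (hF : HasFiltration (fun M => ∃ z : C, lt X z ∧ Nonempty (M ≅ standardModule k lt z))
      U.toFunctor) :
    HasFiltration (fun M => ∃ z : C, lt X z ∧ Nonempty (M ≅ standardModule k lt z))
      W.toFunctor := by
  classical
  refine hasFiltration_of_generators (ι := Σ z, Fin (n z)) (Z := fun p => Z p.1)
    (fun p => hZ p.1 p.2) (fun p => a p.1 p.2) hUW (fun p => ha p.1 p.2) hW
    (fun Y p => hU Y p.1 p.2) ?_ hF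
  rintro Y d hd ⟨z, s⟩
  by_cases hz : z = vertex Y
  · subst hz
    refine hU' Y (fun s => d ⟨_, s⟩) ?_ s
    rw [Fintype.sum_sigma, ← Finset.add_sum_erase _ _ (Finset.mem_univ (vertex Y))] at hd
    -- All coefficients in the groups other than `vertex Y` are in the traces, so these groups
    -- contribute elements of `U` and can be dropped from the relation.
    refine (Submodule.add_mem_iff_left _ (sum_mem fun z hz => sum_mem fun s _ => ?_)).1 hd
    exact hU Y z s _ (hne Y z (Finset.ne_of_mem_erase hz) _)
  · exact hne Y z hz _

end SubProj

/-- Bases of a subquotient `P / Q` of a vector space, and the dual basis. -/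
theorem exists_dual_bases {E : Type*} [AddCommGroup E] [Module k E] [Module.Finite k E]
    (P Q : Submodule k E) :
    ∃ (n : ℕ) (b : Fin n → E) (φ : Fin n → Module.Dual k E), (∀ s, b s ∈ P) ∧
      (∀ s, ∀ g ∈ P, g ∈ Q → φ s g = 0) ∧ (∀ s t, φ s (b t) = if s = t then 1 else 0) ∧
      ∀ g ∈ P, g - ∑ s, φ s g • b s ∈ Q := by
  let e := Module.finBasis k (P ⧸ Q.comap P.subtype)
  have h : ∀ s, ∃ b : P, Submodule.Quotient.mk b = e s := fun s =>
    Submodule.mkQ_surjective _ (e s)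
  choose b hb using h
  -- The coordinate functionals of the subquotient are pulled back to `P` and extended to `E`; their
  -- values off `P` play no role.
  have h : ∀ s, ∃ φ : Module.Dual k E, φ ∘ₗ P.subtype = e.coord s ∘ₗ Submodule.mkQ _ := fun s =>
    LinearMap.exists_extend _
  choose φ hφ using h
  have hφ' : ∀ s (g : P), φ s g.1 = e.coord s (Submodule.Quotient.mk g) := fun s g =>
    LinearMap.congr_fun (hφ s) g
  refine ⟨_, fun s => (b s).1, φ, fun s => (b s).2, ?_, ?_, ?_⟩
  · intro s g hg hgQ
    rw [hφ' s ⟨g, hg⟩, (Submodule.Quotient.mk_eq_zero _).2, map_zero]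
    exact hgQ
  · intro s t
    rw [hφ', hb]
    simp [Finsupp.single_apply, eq_comm]
  · intro g hg
    have h : (⟨g, hg⟩ - ∑ s, φ s g • b s : P) ∈ Q.comap P.subtype := by
      rw [← Submodule.Quotient.mk_eq_zero, ← Submodule.mkQ_apply, map_sub, map_sum]
      simp only [map_smul, Submodule.mkQ_apply, hb]
      rw [sub_eq_zero]
      conv_lhs => rw [← e.sum_repr (Submodule.Quotient.mk ⟨g, hg⟩)]
      exact Finset.sum_congr rfl fun s _ => by rw [hφ' s ⟨g, hg⟩]; rfl
    simpa using h

end Filtrations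

/-! ### Layers of the envelope and its first-order trace -/

section Layers

variable {k : Type w} [Field k] {A : Type u} [Category.{v} A] [Preadditive A] [Linear k A]

theorem HomIdeal.pow_one_hom (J : HomIdeal k A) (x y : A) : (J.pow 1).hom x y = J.hom x y := by
  refine le_antisymm (Submodule.span_le.2 ?_) fun f hf => ?_
  · rintro _ ⟨z, a, b, -, hb, rfl⟩
    exact J.comp_left a hb
  · exact Submodule.subset_span ⟨x, 𝟙 x, f, Submodule.mem_top, hf, by simp⟩

namespace QuotCat

variable {J : HomIdeal k A} {N : ℕ}

/-- The morphism of `𝔅 / ℑ` given by a morphism of `A` in the appropriate power of `J`. -/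
def lift {X Y : QuotCat (Shifted.cutIdeal J N)} (g : X.as.obj ⟶ Y.as.obj)
    (hg : g ∈ (J.pow (Y.as.deg - X.as.deg).toNat).hom X.as.obj Y.as.obj) : X ⟶ Y :=
  Submodule.Quotient.mk (p := (Shifted.cutIdeal J N).hom X.as Y.as) ⟨g, hg⟩

variable {X Y Z : QuotCat (Shifted.cutIdeal J N)}

theorem exists_lift (f : X ⟶ Y) : ∃ g hg, f = lift g hg := by
  obtain ⟨g, rfl⟩ := Submodule.mkQ_surjective _ f
  exact ⟨g.1, g.2, rfl⟩

theorem lift_eq_zero_iff (g : X.as.obj ⟶ Y.as.obj) (hg) :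
    (lift g hg : X ⟶ Y) = 0 ↔
      g ∈ (J.pow (N + (Y.as.deg - X.as.deg)).toNat).hom X.as.obj Y.as.obj :=
  Submodule.Quotient.mk_eq_zero _

theorem lift_comp (f : X.as.obj ⟶ Y.as.obj) (hf) (g : Y.as.obj ⟶ Z.as.obj) (hg) :
    (lift f hf : X ⟶ Y) ≫ (lift g hg : Y ⟶ Z) =
      lift (f ≫ g) (J.comp_mem_pow (by omega) hf hg) := rfl

theorem lift_sub (f g : X.as.obj ⟶ Y.as.obj) (hf hg) :
    (lift (f - g) (sub_mem hf hg) : X ⟶ Y) = lift f hf - lift g hg := rfl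

theorem lift_smul (c : k) (f : X.as.obj ⟶ Y.as.obj) (hf) :
    (lift (c • f) (Submodule.smul_mem _ c hf) : X ⟶ Y) = c • lift f hf := rfl

theorem lift_sum {ι : Type*} (s : Finset ι) (f : ι → (X.as.obj ⟶ Y.as.obj))
    (hf : ∀ i, f i ∈ (J.pow (Y.as.deg - X.as.deg).toNat).hom X.as.obj Y.as.obj) :
    (lift (∑ i ∈ s, f i) (sum_mem fun i _ => hf i) : X ⟶ Y) = ∑ i ∈ s, lift (f i) (hf i) := by
  classical
  induction s using Finset.induction_on with
  | empty => simp only [Finset.sum_empty]; rfl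
  | insert i s hi ih => simp only [Finset.sum_insert hi, ← ih]; rfl

theorem id_eq_lift : 𝟙 X = lift (𝟙 X.as.obj) (by rw [sub_self]; exact Submodule.mem_top) := rfl

/-- The ideal of `𝔅 / ℑ` of those morphisms that are represented by elements of `J ^ m`. -/
def layer (J : HomIdeal k A) (N m : ℕ) : HomIdeal k (QuotCat (Shifted.cutIdeal J N)) where
  hom X Y :=
    { carrier := {f | ∃ g hg, g ∈ (J.pow m).hom X.as.obj Y.as.obj ∧ f = lift g hg}
      zero_mem' := ⟨0, zero_mem _, zero_mem _, rfl⟩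
      add_mem' := by
        rintro _ _ ⟨f, hf, hf', rfl⟩ ⟨g, hg, hg', rfl⟩
        exact ⟨f + g, add_mem hf hg, add_mem hf' hg', rfl⟩
      smul_mem' := by
        rintro c _ ⟨f, hf, hf', rfl⟩
        exact ⟨c • f, Submodule.smul_mem _ c hf, Submodule.smul_mem _ c hf', rfl⟩ }
  comp_left := by
    rintro X Y Z a _ ⟨f, hf, hf', rfl⟩
    obtain ⟨a, ha, rfl⟩ := exists_lift a
    exact ⟨a ≫ f, J.comp_mem_pow (by omega) ha hf, (J.pow m).comp_left a hf', rfl⟩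
  comp_right := by
    rintro X Y Z _ b ⟨f, hf, hf', rfl⟩
    obtain ⟨b, hb, rfl⟩ := exists_lift b
    exact ⟨f ≫ b, J.comp_mem_pow (by omega) hf hb, (J.pow m).comp_right b hf', rfl⟩

theorem lift_mem_layer {m : ℕ} {g : X.as.obj ⟶ Y.as.obj} {hg}
    (h : g ∈ (J.pow m).hom X.as.obj Y.as.obj) :
    (lift g hg : X ⟶ Y) ∈ (layer J N m).hom X Y := ⟨g, hg, h, rfl⟩

/-- Below the cut, membership of `lift g` in a layer can be read off from `g`. -/
theorem lift_mem_layer_iff {m : ℕ} {g : X.as.obj ⟶ Y.as.obj} {hg}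
    (h : (m : ℤ) ≤ N + (Y.as.deg - X.as.deg)) :
    (lift g hg : X ⟶ Y) ∈ (layer J N m).hom X Y ↔ g ∈ (J.pow m).hom X.as.obj Y.as.obj := by
  refine ⟨?_, lift_mem_layer⟩
  rintro ⟨f, hf, hf', h'⟩
  -- Two representatives differ by an element of the cut, which lies in `J ^ m` under the degree
  -- hypothesis.
  rw [← sub_eq_zero, ← lift_sub, lift_eq_zero_iff] at h'
  have := J.pow_anti (show m ≤ (N + (Y.as.deg - X.as.deg)).toNat by omega) _ _ h'
  simpa using add_mem this hf'

theorem layer_anti {m n : ℕ} (h : m ≤ n) : layer J N n ≤ layer J N m := by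
  rintro X Y _ ⟨g, hg, hg', rfl⟩
  exact lift_mem_layer (J.pow_anti h _ _ hg')

theorem comp_mem_layer {m n : ℕ} {f : X ⟶ Y} {g : Y ⟶ Z} (hf : f ∈ (layer J N m).hom X Y)
    (hg : g ∈ (layer J N n).hom Y Z) : f ≫ g ∈ (layer J N (m + n)).hom X Z := by
  obtain ⟨f, hf, hf', rfl⟩ := hf
  obtain ⟨g, hg, hg', rfl⟩ := hg
  exact lift_mem_layer (J.comp_mem_pow le_rfl hf' hg')

theorem mem_layer_of_le {m : ℕ} (h : (m : ℤ) ≤ Y.as.deg - X.as.deg) (f : X ⟶ Y) :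
    f ∈ (layer J N m).hom X Y := by
  obtain ⟨f, hf, rfl⟩ := exists_lift f
  exact lift_mem_layer (J.pow_anti (by omega) _ _ hf)

theorem mem_layer_zero (f : X ⟶ Y) : f ∈ (layer J N 0).hom X Y := by
  obtain ⟨f, hf, rfl⟩ := exists_lift f
  exact lift_mem_layer Submodule.mem_top

theorem eq_zero_of_mem_layer {m : ℕ} (h : (N : ℤ) + (Y.as.deg - X.as.deg) ≤ m) {f : X ⟶ Y}
    (hf : f ∈ (layer J N m).hom X Y) : f = 0 := by
  obtain ⟨f, hf, hf', rfl⟩ := hf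
  exact (lift_eq_zero_iff _ _).2 (J.pow_anti (by omega) _ _ hf')

theorem eq_zero_of_deg_le (h : Y.as.deg ≤ X.as.deg - N) (f : X ⟶ Y) : f = 0 :=
  eq_zero_of_mem_layer (m := 0) (by omega) (mem_layer_zero f)

theorem eq_zero_of_mem_layer_top (hN : J.pow N = ⊥) {f : X ⟶ Y}
    (hf : f ∈ (layer J N N).hom X Y) : f = 0 := by
  obtain ⟨f, hf, hf', rfl⟩ := hf
  rw [hN] at hf'
  obtain rfl : f = 0 := hf'
  rfl

theorem eq_zero_of_le_deg (hN : J.pow N = ⊥) (h : X.as.deg + N ≤ Y.as.deg) (f : X ⟶ Y) : f = 0 :=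
  eq_zero_of_mem_layer_top hN (mem_layer_of_le (by omega) f)

/-- The morphism `x[i] ⟶ x[j]`, `j ≤ i`, given by the identity of `x`. -/
def shift (x : A) {i j : ℤ} (h : j ≤ i) :
    (⟨⟨x, i⟩⟩ : QuotCat (Shifted.cutIdeal J N)) ⟶ ⟨⟨x, j⟩⟩ :=
  lift (𝟙 x) (by
    have h : (j - i).toNat = 0 := by omega
    change 𝟙 x ∈ (J.pow (j - i).toNat).hom x x
    rw [h]; exact Submodule.mem_top)

theorem lift_comp_shift {y : A} {i j : ℤ} (h : j ≤ i) (g : X.as.obj ⟶ y) (hg hg') :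
    (lift g hg : X ⟶ ⟨⟨y, i⟩⟩) ≫ shift y h = lift g hg' := by
  refine (lift_comp _ _ _ _).trans ?_
  congr 1
  exact Category.comp_id g

theorem shift_comp_lift {y : A} {i j : ℤ} (h : j ≤ i) (g : y ⟶ X.as.obj) (hg hg') :
    shift y h ≫ (lift g hg : ⟨⟨y, j⟩⟩ ⟶ X) = lift g hg' := by
  refine (lift_comp _ _ _ _).trans ?_
  congr 1
  exact Category.id_comp g

/-- The functional on a morphism space of `𝔅 / ℑ` given by one on a morphism space of `A`. -/
def functional (φ : Module.Dual k (X.as.obj ⟶ Y.as.obj))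
    (h : ∀ g ∈ (J.pow (N + (Y.as.deg - X.as.deg)).toNat).hom X.as.obj Y.as.obj, φ g = 0) :
    Module.Dual k (X ⟶ Y) :=
  Submodule.liftQ ((Shifted.cutIdeal J N).hom X.as Y.as)
    (φ ∘ₗ Submodule.subtype ((J.pow (Y.as.deg - X.as.deg).toNat).hom X.as.obj Y.as.obj))
    fun g hg => h g.1 hg

end QuotCat

/-- The properties of the radical `J` of a basic finite-dimensional algebra with residue field `k`
that are used below, with two disjoint classes of objects such that `J ^ (N - 1)` only goes from
the second to the first. -/
structure IsSplitRadical (J : HomIdeal k A) (N : ℕ) (isNew isOld : A → Prop) : Prop where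
  finite_obj : Finite A
  finite_hom : ∀ x y : A, Module.Finite k (x ⟶ y)
  pow_eq_bot : J.pow N = ⊥
  mem_of_ne : ∀ {x y : A}, x ≠ y → ∀ f : x ⟶ y, f ∈ J.hom x y
  exists_scalar : ∀ {x : A} (f : x ⟶ x), ∃ c : k, f - c • 𝟙 x ∈ J.hom x x
  one_notMem : ∀ x : A, 𝟙 x ∉ J.hom x x
  last_layer : ∀ {x y : A} (f : y ⟶ x), f ∈ (J.pow (N - 1)).hom y x → f ≠ 0 → isNew x ∧ isOld y
  disjoint : ∀ {x : A}, isNew x → ¬ isOld x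

/-- The first order on the objects of `𝔅 / ℑ`. -/
def layerLT (J : HomIdeal k A) (N : ℕ) (isNew isOld : A → Prop)
    (X Y : QuotCat (Shifted.cutIdeal J N)) : Prop :=
  X.as.deg < Y.as.deg ∨ (X.as.deg = Y.as.deg ∧ isNew X.as.obj ∧ isOld Y.as.obj)

/-- The same order on the objects of the trivial extension. -/
def layerLTD (J : HomIdeal k A) (N : ℕ) (isNew isOld : A → Prop)
    (X Y : TrivExt k (QuotCat (Shifted.cutIdeal J N))) : Prop :=
  layerLT J N isNew isOld X.as Y.as

namespace IsSplitRadical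

open QuotCat

variable {J : HomIdeal k A} {N : ℕ} {isNew isOld : A → Prop}

theorem pos (h : IsSplitRadical J N isNew isOld) (x : A) : 0 < N := by
  rcases Nat.eq_zero_or_pos N with rfl | hN
  · have h0 : 𝟙 x ∈ (J.pow 0).hom x x := Submodule.mem_top
    rw [h.pow_eq_bot] at h0
    refine absurd ?_ (h.one_notMem x)
    rw [show 𝟙 x = 0 from h0]
    exact zero_mem _
  · exact hN

theorem mem_layer_one (h : IsSplitRadical J N isNew isOld)
    {X Y : QuotCat (Shifted.cutIdeal J N)} (hXY : X.as.obj ≠ Y.as.obj) (f : X ⟶ Y) :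
    f ∈ (layer J N 1).hom X Y := by
  obtain ⟨f, hf, rfl⟩ := exists_lift f
  refine lift_mem_layer ?_
  rw [HomIdeal.pow_one_hom]
  exact h.mem_of_ne hXY f

theorem mem_layer_one_of_lt (h : IsSplitRadical J N isNew isOld)
    {X Y : QuotCat (Shifted.cutIdeal J N)} (hXY : layerLT J N isNew isOld X Y) (f : X ⟶ Y) :
    f ∈ (layer J N 1).hom X Y := by
  rcases hXY with hXY | ⟨-, hX, hY⟩
  · exact mem_layer_of_le (by push_cast; omega) f
  · refine h.mem_layer_one ?_ f
    intro e
    exact h.disjoint hX (e ▸ hY)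

/-- Morphisms into larger objects lie in layer 1: either the degree rises, or the vertices differ
because one is new and the other old. Conversely, if the degree does not rise, a representative in
`J` also defines a morphism into degree `X.as.deg + 1`, from which a shift leads back down. -/
theorem traceSub_eq (h : IsSplitRadical J N isNew isOld)
    (X Y : QuotCat (Shifted.cutIdeal J N)) :
    traceSub k (layerLT J N isNew isOld) X Y = (layer J N 1).hom X Y := by
  refine le_antisymm (Submodule.span_le.2 ?_) ?_
  · rintro _ ⟨Z, a, b, hZ, rfl⟩
    exact (layer J N 1).comp_right b (h.mem_layer_one_of_lt hZ a)
  · rintro _ ⟨f, hf, hf', rfl⟩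
    rcases lt_or_ge X.as.deg Y.as.deg with hXY | hXY
    · exact Submodule.subset_span ⟨Y, lift f hf, 𝟙 Y, Or.inl hXY, by simp⟩
    · refine Submodule.subset_span ⟨⟨⟨Y.as.obj, X.as.deg + 1⟩⟩, lift f ?_,
        shift Y.as.obj (show Y.as.deg ≤ X.as.deg + 1 by omega), Or.inl (by change _ < X.as.deg + 1; omega), ?_⟩
      · change f ∈ (J.pow (X.as.deg + 1 - X.as.deg).toNat).hom _ _
        rwa [show (X.as.deg + 1 - X.as.deg).toNat = 1 by omega]
      · exact (lift_comp_shift _ _ _ _).symm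

/-- Modulo the first layer, a morphism `x[i] ⟶ x[j]`, `j ≤ i`, is a multiple of the shift. -/
theorem exists_smul_shift (h : IsSplitRadical J N isNew isOld) {x : A} {i j : ℤ} (hij : j ≤ i)
    (f : (⟨⟨x, i⟩⟩ : QuotCat (Shifted.cutIdeal J N)) ⟶ ⟨⟨x, j⟩⟩) :
    ∃ c : k, f - c • shift x hij ∈ (layer J N 1).hom _ _ := by
  obtain ⟨f, hf, rfl⟩ := exists_lift f
  obtain ⟨c, hc⟩ := h.exists_scalar f
  refine ⟨c, f - c • 𝟙 x, ?_, ?_, rfl⟩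
  · change _ ∈ (J.pow (j - i).toNat).hom x x
    rw [show (j - i).toNat = 0 by omega]
    exact Submodule.mem_top
  · rwa [HomIdeal.pow_one_hom]

theorem id_notMem_layer (h : IsSplitRadical J N isNew isOld)
    (X : QuotCat (Shifted.cutIdeal J N)) : 𝟙 X ∉ (layer J N 1).hom X X := by
  rw [id_eq_lift, lift_mem_layer_iff, HomIdeal.pow_one_hom]
  · exact h.one_notMem _
  · have := h.pos X.as.obj
    push_cast; omega

end IsSplitRadical

end Layers

/-! ### Symmetry, and the trace in the trivial extension -/

section TrivialExtensionLayers

open QuotCat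

namespace TrivExt

variable {k : Type w} [Field k] {C : Type u} [Category.{v} C] [Preadditive C] [Linear k C]

/-- The first component of a morphism of the trivial extension. -/
def fstₗ (X Y : TrivExt k C) : (X ⟶ Y) →ₗ[k] (X.as ⟶ Y.as) := LinearMap.fst k _ _

/-- The second component of a morphism of the trivial extension. -/
def sndₗ (X Y : TrivExt k C) : (X ⟶ Y) →ₗ[k] Module.Dual k (Y.as ⟶ X.as) := LinearMap.snd k _ _

/-- The inclusion of the morphisms of the original category in those of the trivial extension. -/
def inlₗ (X Y : TrivExt k C) : (X.as ⟶ Y.as) →ₗ[k] (X ⟶ Y) := LinearMap.inl k _ _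

@[simp]
theorem inlₗ_fst {X Y : TrivExt k C} (f : X.as ⟶ Y.as) : (inlₗ X Y f).1 = f := rfl

@[simp]
theorem fstₗ_apply {X Y : TrivExt k C} (f : X ⟶ Y) : fstₗ X Y f = f.1 := rfl

@[simp]
theorem add_fst {X Y : TrivExt k C} (f g : X ⟶ Y) : (f + g).1 = f.1 + g.1 := rfl

@[simp]
theorem add_snd {X Y : TrivExt k C} (f g : X ⟶ Y) : (f + g).2 = f.2 + g.2 := rfl

@[simp]
theorem sub_fst {X Y : TrivExt k C} (f g : X ⟶ Y) : (f - g).1 = f.1 - g.1 := rfl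

@[simp]
theorem sub_snd {X Y : TrivExt k C} (f g : X ⟶ Y) : (f - g).2 = f.2 - g.2 := rfl

@[simp]
theorem zero_fst {X Y : TrivExt k C} : (0 : X ⟶ Y).1 = 0 := rfl

@[simp]
theorem zero_snd {X Y : TrivExt k C} : (0 : X ⟶ Y).2 = 0 := rfl

@[simp]
theorem sum_fst {X Y : TrivExt k C} {ι : Type*} (s : Finset ι) (f : ι → (X ⟶ Y)) :
    (∑ i ∈ s, f i).1 = ∑ i ∈ s, (f i).1 := map_sum (fstₗ X Y) f s

@[simp]
theorem sum_snd {X Y : TrivExt k C} {ι : Type*} (s : Finset ι) (f : ι → (X ⟶ Y)) :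
    (∑ i ∈ s, f i).2 = ∑ i ∈ s, (f i).2 := map_sum (sndₗ X Y) f s

@[simp]
theorem smul_fst {X Y : TrivExt k C} (c : k) (f : X ⟶ Y) : (c • f).1 = c • f.1 := rfl

@[simp]
theorem smul_snd {X Y : TrivExt k C} (c : k) (f : X ⟶ Y) : (c • f).2 = c • f.2 := rfl

/-- A trivial extension is symmetric. -/
theorem isSymmetric : IsSymmetric k (TrivExt k C) := by
  -- The trace form evaluates the dual component at the identity.
  refine ⟨fun X => (LinearMap.applyₗ (𝟙 X.as)) ∘ₗ sndₗ X X, fun X Y f g => ?_, fun X Y f hf => ?_⟩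
  · change (f ≫ g).2 (𝟙 X.as) = (g ≫ f).2 (𝟙 Y.as)
    rw [comp_snd_apply, comp_snd_apply, Category.id_comp, Category.comp_id, Category.id_comp,
      Category.comp_id, add_comm]
  -- Pairing with `(0, φ)` detects the first component of `f`, pairing with `(g, 0)` the second.
  · have hf' : ∀ (g : Y.as ⟶ X.as) (φ : Module.Dual k (X.as ⟶ Y.as)), φ f.1 + f.2 g = 0 := by
      intro g φ
      have h : (f ≫ (show Y ⟶ X from (g, φ))).2 (𝟙 X.as) = 0 := hf (g, φ)
      rw [comp_snd_apply, Category.id_comp, Category.comp_id] at h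
      exact h
    refine Prod.ext ((Module.forall_dual_apply_eq_zero_iff k f.1).1 fun φ => ?_)
      (LinearMap.ext fun g => ?_)
    · simpa using hf' 0 φ
    · simpa using hf' g 0

end TrivExt

variable {k : Type w} [Field k] {A : Type u} [Category.{v} A] [Preadditive A] [Linear k A]
variable {J : HomIdeal k A} {N : ℕ}

/-- The submodule of `P(X)` of those morphisms whose first component is in the layer `m`. -/
def fstSub (m : ℕ) (X : TrivExt k (QuotCat (Shifted.cutIdeal J N))) : SubProj k X where
  hom Y := ((layer J N m).hom X.as Y.as).comap (TrivExt.fstₗ X Y)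
  comp b hf := (layer J N m).comp_right b.1 hf

/-- The submodule of `P(X)` of those elements of the dual bimodule that vanish on the
layer `m`. -/
def sndSub (m : ℕ) (X : TrivExt k (QuotCat (Shifted.cutIdeal J N))) : SubProj k X where
  hom Y :=
    { carrier := {f | f.1 = 0 ∧ ∀ h ∈ (layer J N m).hom Y.as X.as, f.2 h = 0}
      zero_mem' := ⟨rfl, fun _ _ => rfl⟩
      add_mem' := by
        rintro f g ⟨hf, hf'⟩ ⟨hg, hg'⟩
        exact ⟨by simp [hf, hg], fun h hh => by simp [hf' h hh, hg' h hh]⟩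
      smul_mem' := by
        rintro c f ⟨hf, hf'⟩
        exact ⟨by simp [hf], fun h hh => by simp [hf' h hh]⟩ }
  comp {Y Z f} b := by
    rintro ⟨hf, hf'⟩
    refine ⟨by simp [hf], fun h hh => ?_⟩
    rw [TrivExt.comp_snd_apply, hf, Limits.comp_zero, map_zero, zero_add]
    exact hf' _ ((layer J N m).comp_left b.1 hh)

theorem mem_fstSub {m : ℕ} {X Y : TrivExt k (QuotCat (Shifted.cutIdeal J N))} {f : X ⟶ Y} :
    f ∈ (fstSub m X).hom Y ↔ f.1 ∈ (layer J N m).hom X.as Y.as := Iff.rfl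

namespace IsSplitRadical

variable {isNew isOld : A → Prop}

/-- Elements of the dual bimodule that generate `sndSub (m + 1) X` modulo `sndSub m X`. -/
theorem exists_snd_generators (h : IsSplitRadical J N isNew isOld) (m : ℕ)
    (X : TrivExt k (QuotCat (Shifted.cutIdeal J N))) {l : ℤ} (hl : l = X.as.as.deg - m + N - 1) :
    ∃ (n : A → ℕ) (a : ∀ z, Fin (n z) → (X ⟶ ⟨⟨⟨z, l⟩⟩⟩)) (b : ∀ z, Fin (n z) → (z ⟶ X.as.as.obj)),
      (∀ z s, (a z s).1 = 0) ∧ (∀ z s, b z s ∈ (J.pow m).hom z X.as.as.obj) ∧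
      (∀ z s t hg, (a z s).2 (lift (b z t) hg) = if s = t then 1 else 0) ∧
      (∀ z, ∀ g ∈ (J.pow m).hom z X.as.as.obj, ∃ c : Fin (n z) → k,
        (∀ s hg, (a z s).2 (lift g hg) = c s) ∧
        g - ∑ s, c s • b z s ∈ (J.pow (m + 1)).hom z X.as.as.obj) := by
  have := h.finite_hom
  choose n b φ hb hφ hφb hspan using fun z => exists_dual_bases (k := k)
    ((J.pow m).hom z X.as.as.obj) ((J.pow (m + 1)).hom z X.as.as.obj)
  -- The degree `l` is chosen so that morphisms from `(z, l)` to `X` are taken modulo exactly `J ^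
  -- (m + 1)`; functionals vanishing there descend.
  have hdeg : (N + (X.as.as.deg - l)).toNat = m + 1 := by omega
  have hφ' : ∀ z s, ∀ g ∈ (J.pow (N + (X.as.as.deg - l)).toNat).hom z X.as.as.obj, φ z s g = 0 := by
    intro z s g hg
    rw [hdeg] at hg
    exact hφ z s g (J.pow_anti (Nat.le_succ m) _ _ hg) hg
  refine ⟨n, fun z s => (0, functional (X := ⟨⟨z, l⟩⟩) (Y := X.as) (φ z s) (hφ' z s)), b,
    fun _ _ => rfl, hb, fun z s t hg => hφb z s t, fun z g hg => ⟨fun s => φ z s g, fun s hg' => rfl,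
    hspan z g hg⟩⟩

theorem mem_pow_of_nonpos {x y : A} {d : ℤ} (hd : d ≤ 0) (f : x ⟶ y) :
    f ∈ (J.pow d.toNat).hom x y := by
  rw [show d.toNat = 0 by omega]
  exact Submodule.mem_top

/-- Modulo `sndSub m`, a functional vanishing on layer `m + 1` is known from its values on `J ^ m /
J ^ (m + 1)`, and shifted generators realise all such values. The ambient `S` is arbitrary so that
it can be both the trace and the submodule adjoined in the filtration. -/
theorem snd_generators_span {m : ℕ} (hm : m < N)
    {X : TrivExt k (QuotCat (Shifted.cutIdeal J N))} {l : ℤ} (hl : l = X.as.as.deg - m + N - 1)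
    {n : A → ℕ} {a : ∀ z, Fin (n z) → (X ⟶ ⟨⟨⟨z, l⟩⟩⟩)} {b : ∀ z, Fin (n z) → (z ⟶ X.as.as.obj)}
    (ha : ∀ z s, (a z s).1 = 0) (hb : ∀ z s, b z s ∈ (J.pow m).hom z X.as.as.obj)
    (hspan : ∀ z, ∀ g ∈ (J.pow m).hom z X.as.as.obj, ∃ c : Fin (n z) → k,
        (∀ s hg, (a z s).2 (lift g hg) = c s) ∧
        g - ∑ s, c s • b z s ∈ (J.pow (m + 1)).hom z X.as.as.obj)
    (S : SubProj k X) (hS : ∀ Y, (sndSub m X).hom Y ≤ S.hom Y)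
    (hSa : ∀ Y z s (d : (⟨⟨⟨z, l⟩⟩⟩ : TrivExt k (QuotCat (Shifted.cutIdeal J N))) ⟶ Y),
      a z s ≫ d ∈ S.hom Y) (Y) :
    (sndSub (m + 1) X).hom Y ≤ S.hom Y := by
  rintro f ⟨hf, hf'⟩
  obtain ⟨⟨⟨y, j⟩⟩⟩ := Y
  change ∀ h ∈ (layer J N (m + 1)).hom ⟨⟨y, j⟩⟩ X.as, f.2 h = 0 at hf'
  -- Here every morphism `(y, j) ⟶ X` lies in layer `m + 1`, so `f` vanishes on all of them.
  by_cases h1 : (m : ℤ) < X.as.as.deg - j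
  · refine hS _ ⟨hf, fun g hg => hf' _ ?_⟩
    exact mem_layer_of_le (by push_cast; exact h1) g
  -- Above degree `l` the cut kills layer `m` of the morphisms into `X`, so vanishing on it is no
  -- condition.
  by_cases h2 : l < j
  · refine hS _ ⟨hf, fun g hg => ?_⟩
    rw [eq_zero_of_mem_layer (by change (N : ℤ) + (X.as.as.deg - j) ≤ m; omega) hg, map_zero]
  push Not at h1 h2
  have hb' : ∀ s, b y s ∈ (J.pow (X.as.as.deg - j).toNat).hom y X.as.as.obj := fun s =>
    J.pow_anti (by omega) _ _ (hb y s)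
  let σ : (⟨⟨⟨y, l⟩⟩⟩ : TrivExt k (QuotCat (Shifted.cutIdeal J N))) ⟶ ⟨⟨⟨y, j⟩⟩⟩ := (shift y h2, 0)
  -- By duality, the coefficient of each generator is the value of `f` on the corresponding basis
  -- vector; `σ` brings the generators down from degree `l` to `j`.
  let c : Fin (n y) → k := fun s => f.2 (lift (b y s) (hb' s))
  have hsum : ∑ s, a y s ≫ (c s • σ) ∈ S.hom ⟨⟨⟨y, j⟩⟩⟩ := sum_mem fun s _ => hSa _ _ _ _
  rw [← sub_add_cancel f (∑ s, a y s ≫ (c s • σ))]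
  refine add_mem (hS _ ⟨?_, ?_⟩) hsum
  · simp [hf, ha]
  · rintro _ ⟨g, hg, hgm, rfl⟩
    obtain ⟨e, he, he'⟩ := hspan y g hgm
    have h3 := hf' (lift (g - ∑ s, e s • b y s) (sub_mem hg (sum_mem fun s _ =>
      Submodule.smul_mem _ _ (hb' s)))) (lift_mem_layer he')
    rw [lift_sub _ _ hg (sum_mem fun s _ => Submodule.smul_mem _ _ (hb' s)),
      lift_sum _ _ (fun s => Submodule.smul_mem _ _ (hb' s)), map_sub, map_sum, sub_eq_zero] at h3
    rw [TrivExt.sub_snd, LinearMap.sub_apply, h3, TrivExt.sum_snd, LinearMap.sum_apply, sub_eq_zero]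
    refine Finset.sum_congr rfl fun s _ => ?_
    rw [Linear.comp_smul, TrivExt.smul_snd, LinearMap.smul_apply, TrivExt.comp_snd_apply, ha,
      Limits.comp_zero, map_zero, zero_add]
    change _ = c s • (a y s).2 (shift y h2 ≫ lift g hg)
    rw [shift_comp_lift h2 g hg (mem_pow_of_nonpos (show X.as.as.deg - l ≤ 0 by omega) _), he, lift_smul, map_smul,
      smul_eq_mul, smul_eq_mul, mul_comm]

/-- The degree `l` exceeds that of `X` by `N - 1 - m`, so a tie occurs only for `m = N - 1`; there
`last_layer` supplies the second clause of the order. -/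
theorem lt_of_snd_generator (h : IsSplitRadical J N isNew isOld) {m : ℕ} (hm : m < N)
    (X : TrivExt k (QuotCat (Shifted.cutIdeal J N))) {l : ℤ} (hl : l = X.as.as.deg - m + N - 1)
    {z : A} {g : z ⟶ X.as.as.obj} (hg : g ∈ (J.pow m).hom z X.as.as.obj) (hg' : g ≠ 0) :
    layerLTD J N isNew isOld X ⟨⟨⟨z, l⟩⟩⟩ := by
  by_cases hmN : m = N - 1
  · subst hmN
    exact Or.inr ⟨by change _ = l; omega, h.last_layer g hg hg'⟩
  · exact Or.inl (by change _ < l; omega)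

theorem sndSub_zero (X Y : TrivExt k (QuotCat (Shifted.cutIdeal J N))) :
    (sndSub 0 X).hom Y = ⊥ := by
  refine (Submodule.eq_bot_iff _).2 fun f hf => ?_
  exact Prod.ext hf.1 (LinearMap.ext fun g => hf.2 g (mem_layer_zero g))

/-- Layer `N` is zero because `J ^ N = 0`, so both sides are the whole dual bimodule. This joins the
two halves of the filtration. -/
theorem sndSub_top (h : IsSplitRadical J N isNew isOld)
    (X : TrivExt k (QuotCat (Shifted.cutIdeal J N))) : sndSub N X = fstSub N X := by
  ext Y f
  refine ⟨fun hf => ?_, fun hf => ?_⟩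
  · rw [mem_fstSub, hf.1]
    exact zero_mem _
  · refine ⟨eq_zero_of_mem_layer_top h.pow_eq_bot hf, fun g hg => ?_⟩
    rw [eq_zero_of_mem_layer_top h.pow_eq_bot hg, map_zero]

/-- The trace, as a submodule of `P(X)`. -/
def traceSubProj {k : Type w} [Field k] {C : Type u} [Category.{v} C] [Preadditive C] [Linear k C]
    (lt : C → C → Prop) (X : C) : SubProj k X where
  hom Y := traceSub k lt X Y
  comp b hf := traceSub_comp lt hf b

/-- Each step of the dual bimodule is generated, modulo the previous one, by morphisms into larger
objects. For `m = N` this absorbs all of ℭ^* into the trace. -/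
theorem sndSub_le_trace (h : IsSplitRadical J N isNew isOld) {m : ℕ} (hm : m ≤ N)
    (X Y : TrivExt k (QuotCat (Shifted.cutIdeal J N))) :
    (sndSub m X).hom Y ≤ traceSub k (layerLTD J N isNew isOld) X Y := by
  induction m generalizing Y with
  | zero => rw [sndSub_zero]; exact bot_le
  | succ m ih =>
    obtain ⟨n, a, b, ha, hb, hab, hspan⟩ := h.exists_snd_generators m X rfl
    refine snd_generators_span hm rfl ha hb hspan (traceSubProj _ X)
      (fun Y => ih (by omega) Y) (fun Y z s d => ?_) Y
    refine Submodule.subset_span ⟨_, a z s, d, h.lt_of_snd_generator hm X rfl (hb z s) ?_, rfl⟩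
    -- A basis vector is nonzero because its dual functional takes the value 1 on it.
    intro h0
    have h1 := hab z s s (mem_pow_of_nonpos
      (show X.as.as.deg - (X.as.as.deg - m + N - 1) ≤ 0 by omega) _)
    simp only [h0, if_true] at h1
    exact zero_ne_one ((map_zero _).symm.trans h1)

/-- First components compose as in ℭ, which bounds the trace from above. For the converse, split a
morphism into its first component, handled by the trace in ℭ, and a remainder in the dual bimodule,
handled by `sndSub_le_trace`. -/
theorem traceSubProj_eq (h : IsSplitRadical J N isNew isOld)
    (X : TrivExt k (QuotCat (Shifted.cutIdeal J N))) :
    traceSubProj (layerLTD J N isNew isOld) X = fstSub 1 X := by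
  ext Y f
  refine ⟨fun hf => ?_, fun hf => ?_⟩
  · refine (Submodule.span_le.2 ?_ :
      traceSub k (layerLTD J N isNew isOld) X Y ≤ (fstSub 1 X).hom Y) hf
    rintro _ ⟨Z, a, b, hZ, rfl⟩
    exact (layer J N 1).comp_right b.1 (h.mem_layer_one_of_lt hZ a.1)
  · have h1 : ∀ g ∈ traceSub k (layerLT J N isNew isOld) X.as Y.as,
        TrivExt.inlₗ X Y g ∈ traceSub k (layerLTD J N isNew isOld) X Y := by
      intro g hg
      induction hg using Submodule.span_induction with
      | mem g hg =>
        obtain ⟨Z, a, b, hZ, rfl⟩ := hg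
        refine Submodule.subset_span ⟨⟨Z⟩, (a, 0), (b, 0), hZ, Prod.ext rfl ?_⟩
        exact LinearMap.ext fun _ => (add_zero _).symm
      | zero => exact zero_mem _
      | add f g _ _ hf hg => rw [map_add]; exact add_mem hf hg
      | smul c f _ hf => rw [map_smul]; exact Submodule.smul_mem _ c hf
    have h2 : f - TrivExt.inlₗ X Y f.1 ∈ traceSub k (layerLTD J N isNew isOld) X Y := by
      refine h.sndSub_le_trace le_rfl X Y ?_
      rw [h.sndSub_top]
      rw [mem_fstSub, TrivExt.sub_fst, TrivExt.inlₗ_fst, sub_self]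
      exact zero_mem _
    have := add_mem h2 (h1 f.1 ((h.traceSub_eq _ _).ge hf))
    rwa [sub_add_cancel] at this

theorem mem_traceD (h : IsSplitRadical J N isNew isOld)
    {X Y : TrivExt k (QuotCat (Shifted.cutIdeal J N))} {f : X ⟶ Y} :
    f ∈ traceSub k (layerLTD J N isNew isOld) X Y ↔ f.1 ∈ (layer J N 1).hom X.as Y.as := by
  rw [← mem_fstSub, ← h.traceSubProj_eq]; rfl

end IsSplitRadical

end TrivialExtensionLayers

/-! ### The filtration of the trace by standard modules -/

section LayerFiltrations

open QuotCat

variable {k : Type w} [Field k] {A : Type u} [Category.{v} A] [Preadditive A] [Linear k A]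
variable {J : HomIdeal k A} {N : ℕ} {isNew isOld : A → Prop}

namespace IsSplitRadical

/-- The modules that occur as subquotients in the filtration of the trace. -/
abbrev standardClass (J : HomIdeal k A) (N : ℕ) (isNew isOld : A → Prop)
    (X : TrivExt k (QuotCat (Shifted.cutIdeal J N))) :
    (TrivExt k (QuotCat (Shifted.cutIdeal J N)) ⥤ ModuleCat.{max v w} k) → Prop :=
  fun M => ∃ Z, layerLTD J N isNew isOld X Z ∧
    Nonempty (M ≅ standardModule k (layerLTD J N isNew isOld) Z)

/-- Precomposition with layer 1 sends layer `m` into layer `m + 1`, which the cut kills in degree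
`l`; hence the traces annihilate the generators modulo `sndSub m`. Evaluation on the basis vectors
`b` shows that there are no further relations. -/
theorem hasFiltration_sndSub_succ (h : IsSplitRadical J N isNew isOld) {m : ℕ} (hm : m < N)
    (X : TrivExt k (QuotCat (Shifted.cutIdeal J N)))
    (hF : HasFiltration (standardClass J N isNew isOld X) (sndSub m X).toFunctor) :
    HasFiltration (standardClass J N isNew isOld X) (sndSub (m + 1) X).toFunctor := by
  have := h.finite_obj
  let _ := Fintype.ofFinite A
  obtain ⟨l, hl⟩ : ∃ l : ℤ, l = X.as.as.deg - m + N - 1 := ⟨_, rfl⟩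
  obtain ⟨n, a, b, ha, hb, hab, hspan⟩ := h.exists_snd_generators m X hl
  have hb' : ∀ z s, b z s ∈ (J.pow (X.as.as.deg - l).toNat).hom z X.as.as.obj := fun z s =>
    mem_pow_of_nonpos (by omega) _
  have hne : ∀ z (s : Fin (n z)), b z s ≠ 0 := by
    intro z s h0
    have h1 := hab z s s (hb' z s)
    simp only [h0, if_true] at h1
    exact zero_ne_one ((map_zero _).symm.trans h1)
  have hcomp : ∀ (z s) (Y : TrivExt k (QuotCat (Shifted.cutIdeal J N)))
      (d : (⟨⟨⟨z, l⟩⟩⟩ : TrivExt k (QuotCat (Shifted.cutIdeal J N))) ⟶ Y) (g : Y.as ⟶ X.as),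
      (a z s ≫ d).2 g = (a z s).2 (d.1 ≫ g) := by
    intro z s Y d g
    rw [TrivExt.comp_snd_apply, ha, Limits.comp_zero, map_zero, zero_add]
  have hU : ∀ (z s) (Y : TrivExt k (QuotCat (Shifted.cutIdeal J N)))
      (d : (⟨⟨⟨z, l⟩⟩⟩ : TrivExt k (QuotCat (Shifted.cutIdeal J N))) ⟶ Y),
      d.1 ∈ (layer J N 1).hom _ _ → a z s ≫ d ∈ (sndSub m X).hom Y := by
    intro z s Y d hd
    refine ⟨by simp [ha], fun g hg => ?_⟩
    rw [hcomp, eq_zero_of_mem_layer (m := 1 + m) ?_ (comp_mem_layer hd hg), map_zero]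
    change (N : ℤ) + (X.as.as.deg - l) ≤ _
    push_cast; omega
  refine SubProj.hasFiltration_of_grouped_generators (fun Y => Y.as.as.obj) a
    (fun z s => h.lt_of_snd_generator hm X hl (hb z s) (hne z s)) ?_ ?_ ?_ ?_ ?_ ?_ hF
  · rintro Y f ⟨hf, hf'⟩
    exact ⟨hf, fun g hg => hf' g (layer_anti (Nat.le_succ m) _ _ hg)⟩
  · refine fun z s => ⟨ha z s, fun g hg => ?_⟩
    rw [eq_zero_of_mem_layer _ hg, map_zero]
    change (N : ℤ) + (X.as.as.deg - l) ≤ _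
    push_cast; omega
  · intro Y
    refine snd_generators_span hm hl ha hb hspan _ (SubProj.le_adjoin _ _ _)
      (fun Y z s d => ?_) Y
    exact SubProj.comp_mem_adjoin (sndSub m X) (ι := Σ z, Fin (n z))
      (Z := fun p => ⟨⟨⟨p.1, l⟩⟩⟩) (fun p => a p.1 p.2) (s := ⟨z, s⟩) (Finset.mem_univ _) d
  · exact fun Y z s d hd => hU z s Y d (h.mem_traceD.1 hd)
  · exact fun Y z hz d => h.mem_traceD.2 (h.mem_layer_one hz d.1)
  · rintro ⟨⟨⟨y, j⟩⟩⟩ d ⟨-, hd⟩ t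
    change ∀ g ∈ (layer J N m).hom ⟨⟨y, j⟩⟩ X.as, _ at hd
    rw [h.mem_traceD]
    -- For `j > l` every morphism lies in layer 1, and for `j ≤ l - N` the only morphism of ℭ is
    -- zero; in between, `d s` is a multiple of the shift modulo layer 1.
    by_cases h1 : l < j
    · exact mem_layer_of_le (by change ((1 : ℕ) : ℤ) ≤ j - l; push_cast; omega) _
    by_cases h2 : j ≤ l - N
    · rw [eq_zero_of_deg_le h2 (d t).1]
      exact zero_mem _
    push Not at h1 h2
    choose c hc using fun s => h.exists_smul_shift h1 (d s).1
    -- The bound `j > l - N` says that `X.as.as.deg - j ≤ m`, so `b y t` defines a morphism out of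
    -- `(y, j)`.
    have hb'' : b y t ∈ (J.pow (X.as.as.deg - j).toNat).hom y X.as.as.obj :=
      J.pow_anti (by omega) _ _ (hb y t)
    have h3 := hd (lift (b y t) hb'') (lift_mem_layer (hb y t))
    -- Pairing with `b y t` kills the layer 1 parts of all `d s`, and every scalar except `c t`.
    have h4 : ∀ s, (a y s ≫ d s).2 (lift (b y t) hb'') = if s = t then c s else 0 := by
      intro s
      have h5 : ((d s).1 - c s • shift y h1) ≫ lift (b y t) hb'' = 0 := by
        refine eq_zero_of_mem_layer (m := 1 + m) ?_
          (comp_mem_layer (hc s) (lift_mem_layer (hb y t)))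
        change (N : ℤ) + (X.as.as.deg - l) ≤ _
        push_cast; omega
      rw [Preadditive.sub_comp, sub_eq_zero, Linear.smul_comp,
        shift_comp_lift h1 _ _ (hb' y t)] at h5
      rw [hcomp, h5, map_smul, hab, smul_eq_mul, mul_ite, mul_one, mul_zero]
    rw [TrivExt.sum_snd, LinearMap.sum_apply, Finset.sum_congr rfl fun s _ => h4 s,
      Finset.sum_ite_eq' Finset.univ t c, if_pos (Finset.mem_univ t)] at h3
    have h6 := hc t
    rwa [h3, zero_smul, sub_zero] at h6

/-- A basis of `J ^ m / J ^ (m + 1)`, placed in degree `l = X.as.as.deg + m`, generates, and shifts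
reach the lower degrees. The condition `0 < m` makes these objects larger than `X`. -/
theorem hasFiltration_fstSub_pred (h : IsSplitRadical J N isNew isOld) {m : ℕ}
    (hm0 : 0 < m) (X : TrivExt k (QuotCat (Shifted.cutIdeal J N)))
    (hF : HasFiltration (standardClass J N isNew isOld X) (fstSub (m + 1) X).toFunctor) :
    HasFiltration (standardClass J N isNew isOld X) (fstSub m X).toFunctor := by
  have := h.finite_obj
  have := h.finite_hom
  let _ := Fintype.ofFinite A
  obtain ⟨l, hl⟩ : ∃ l : ℤ, l = X.as.as.deg + m := ⟨_, rfl⟩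
  choose n b φ hb hφ hφb hspan using fun z => exists_dual_bases (k := k)
    ((J.pow m).hom X.as.as.obj z) ((J.pow (m + 1)).hom X.as.as.obj z)
  have hbl : ∀ z s, b z s ∈ (J.pow (l - X.as.as.deg).toNat).hom X.as.as.obj z := by
    intro z s
    rw [show (l - X.as.as.deg).toNat = m by omega]
    exact hb z s
  let a' : ∀ z, Fin (n z) → (X.as ⟶ ⟨⟨z, l⟩⟩) := fun z s => lift (b z s) (hbl z s)
  have ha' : ∀ z s, a' z s ∈ (layer J N m).hom _ _ := fun z s => lift_mem_layer (hb z s)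
  let a : ∀ z, Fin (n z) → (X ⟶ ⟨⟨⟨z, l⟩⟩⟩) := fun z s => TrivExt.inlₗ X ⟨⟨⟨z, l⟩⟩⟩ (a' z s)
  have hU : ∀ (z s) (Y : TrivExt k (QuotCat (Shifted.cutIdeal J N)))
      (d : (⟨⟨⟨z, l⟩⟩⟩ : TrivExt k (QuotCat (Shifted.cutIdeal J N))) ⟶ Y),
      d.1 ∈ (layer J N 1).hom _ _ → a z s ≫ d ∈ (fstSub (m + 1) X).hom Y :=
    fun z s Y d hd => comp_mem_layer (ha' z s) hd
  refine SubProj.hasFiltration_of_grouped_generators (fun Y => Y.as.as.obj) a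
    (fun z s => Or.inl (by change X.as.as.deg < l; omega)) ?_ ?_ ?_ ?_ ?_ ?_ hF
  · exact fun Y f hf => layer_anti (Nat.le_succ m) _ _ hf
  · exact fun z s => ha' z s
  · rintro ⟨⟨⟨y, j⟩⟩⟩ f hf
    by_cases h1 : l < j
    · refine SubProj.le_adjoin _ _ _ _ (mem_layer_of_le ?_ f.1)
      change ((m + 1 : ℕ) : ℤ) ≤ j - X.as.as.deg
      push_cast; omega
    push Not at h1
    obtain ⟨g, hg, hgm, hfg⟩ := hf
    rw [TrivExt.fstₗ_apply] at hfg
    let σ : (⟨⟨⟨y, l⟩⟩⟩ : TrivExt k (QuotCat (Shifted.cutIdeal J N))) ⟶ ⟨⟨⟨y, j⟩⟩⟩ :=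
      TrivExt.inlₗ _ _ (shift y h1)
    rw [← sub_add_cancel f (∑ s, a y s ≫ (φ y s g • σ))]
    refine add_mem (SubProj.le_adjoin _ _ _ _ ?_) (sum_mem fun s _ => ?_)
    · have hbj : ∀ s, b y s ∈ (J.pow (j - X.as.as.deg).toNat).hom X.as.as.obj y := fun s =>
        J.pow_anti (by omega) _ _ (hb y s)
      have h3 : ∀ s, (a y s ≫ (φ y s g • σ)).1 =
          lift (φ y s g • b y s) (Submodule.smul_mem _ _ (hbj s)) := by
        intro s
        rw [Linear.comp_smul, TrivExt.smul_fst, TrivExt.comp_fst, lift_smul _ _ (hbj s)]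
        congr 1
        exact lift_comp_shift h1 _ _ _
      rw [mem_fstSub, TrivExt.sub_fst, TrivExt.sum_fst, Finset.sum_congr rfl fun s _ => h3 s,
        hfg, ← lift_sum, ← lift_sub]
      exact lift_mem_layer (hspan y g hgm)
    · exact SubProj.comp_mem_adjoin (fstSub (m + 1) X) (ι := Σ z, Fin (n z))
        (Z := fun p => ⟨⟨⟨p.1, l⟩⟩⟩) (fun p => a p.1 p.2) (s := ⟨y, s⟩) (Finset.mem_univ _) _
  · exact fun Y z s d hd => hU z s Y d (h.mem_traceD.1 hd)
  · exact fun Y z hz d => h.mem_traceD.2 (h.mem_layer_one hz d.1)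
  · rintro ⟨⟨⟨y, j⟩⟩⟩ d hd t
    rw [h.mem_traceD]
    by_cases h1 : l < j
    · exact mem_layer_of_le (by change ((1 : ℕ) : ℤ) ≤ j - l; push_cast; omega) _
    by_cases h2 : j ≤ l - N
    · rw [eq_zero_of_deg_le h2 (d t).1]
      exact zero_mem _
    push Not at h1 h2
    choose c hc using fun s => h.exists_smul_shift h1 (d s).1
    have hbj : ∀ s, b y s ∈ (J.pow (j - X.as.as.deg).toNat).hom X.as.as.obj y := fun s =>
      J.pow_anti (by omega) _ _ (hb y s)
    rw [mem_fstSub, TrivExt.sum_fst] at hd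
    change ∑ s, a' y s ≫ (d s).1 ∈ (layer J N (m + 1)).hom X.as ⟨⟨y, j⟩⟩ at hd
    have h3 : ∑ s, a' y s ≫ ((d s).1 - c s • shift y h1) ∈
        (layer J N (m + 1)).hom X.as ⟨⟨y, j⟩⟩ :=
      sum_mem fun s _ => comp_mem_layer (ha' y s) (hc s)
    have h4 : ∑ s, a' y s ≫ (d s).1 - ∑ s, a' y s ≫ ((d s).1 - c s • shift y h1) =
        lift (Y := ⟨⟨y, j⟩⟩) (∑ s, c s • b y s)
          (sum_mem fun s _ => Submodule.smul_mem _ _ (hbj s)) := by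
      rw [lift_sum _ _ (fun s => Submodule.smul_mem _ _ (hbj s)), ← Finset.sum_sub_distrib]
      refine Finset.sum_congr rfl fun s _ => ?_
      rw [← Preadditive.comp_sub, sub_sub_cancel, Linear.comp_smul, lift_smul _ _ (hbj s)]
      congr 1
      exact lift_comp_shift h1 _ _ _
    have h5 := sub_mem hd h3
    -- Since `j > l - N`, the cut is contained in `J ^ (m + 1)`, so the layer can be read off from
    -- the representative, where the dual functionals isolate `c t`.
    rw [h4, lift_mem_layer_iff
      (by change ((m + 1 : ℕ) : ℤ) ≤ N + (j - X.as.as.deg); push_cast; omega)] at h5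
    have h6 := hφ y t _ (J.pow_anti (Nat.le_succ m) _ _ h5) h5
    simp only [map_sum, map_smul, hφb, smul_eq_mul, mul_ite, mul_one, mul_zero] at h6
    rw [Finset.sum_ite_eq Finset.univ t c, if_pos (Finset.mem_univ t)] at h6
    have h7 := hc t
    rwa [h6, zero_smul, sub_zero] at h7

/-- The trace in `P(X)` has a filtration by standard modules `Δ(Z)`, `Z > X`. -/
theorem hasFiltration_trace (h : IsSplitRadical J N isNew isOld)
    (X : TrivExt k (QuotCat (Shifted.cutIdeal J N))) :
    HasFiltration (standardClass J N isNew isOld X)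
      (traceModule k (layerLTD J N isNew isOld) X) := by
  have h1 : ∀ m ≤ N, HasFiltration (standardClass J N isNew isOld X) (sndSub m X).toFunctor := by
    intro m
    induction m with
    | zero =>
      refine fun _ => HasFiltration.zero _ ((Functor.isZero_iff _).2 fun Y => ?_)
      have : Subsingleton ((sndSub 0 X).hom Y) := by rw [sndSub_zero]; infer_instance
      exact ModuleCat.isZero_of_subsingleton (ModuleCat.of k ((sndSub 0 X).hom Y))
    | succ m ih => exact fun hm => h.hasFiltration_sndSub_succ hm X (ih (by omega))
  -- This is a descending induction from `fstSub N`, which equals `sndSub N`; it stops at `fstSub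
  -- 1`, the trace.
  have h2 : ∀ m ≤ N, 0 < N - m →
      HasFiltration (standardClass J N isNew isOld X) (fstSub (N - m) X).toFunctor := by
    intro m
    induction m with
    | zero =>
      intro _ _
      rw [Nat.sub_zero, ← h.sndSub_top]
      exact h1 N le_rfl
    | succ m ih =>
      intro hm hm'
      refine h.hasFiltration_fstSub_pred hm' X ?_
      rw [show N - (m + 1) + 1 = N - m by omega]
      exact ih (by omega) (by omega)
  have hN := h.pos X.as.as.obj
  have h3 := h2 (N - 1) (by omega) (by omega)
  rw [show N - (N - 1) = 1 by omega, ← h.traceSubProj_eq] at h3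
  exact h3

end IsSplitRadical

end LayerFiltrations

/-! ### Basicness, the order and composition factors of standard modules -/

section LayerQuasiHereditary

open QuotCat

variable {k : Type w} [Field k] {A : Type u} [Category.{v} A] [Preadditive A] [Linear k A]
variable {J : HomIdeal k A} {N : ℕ} {isNew isOld : A → Prop}

namespace IsSplitRadical

theorem pow_mem_layer {X : TrivExt k (QuotCat (Shifted.cutIdeal J N))} {f : End X}
    (hf : f.1 ∈ (layer J N 1).hom X.as X.as) (n : ℕ) :
    (f ^ n : End X).1 ∈ (layer J N n).hom X.as X.as := by
  induction n with
  | zero => exact mem_layer_zero _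
  | succ n ih =>
    rw [pow_succ', End.mul_def]
    exact comp_mem_layer ih hf

/-- The `N`-th power has first component in layer `N`, which is zero, so it lies in the dual
bimodule, whose square is zero; hence the exponent `N * 2`. -/
theorem isNilpotent_of_mem_layer (h : IsSplitRadical J N isNew isOld)
    {X : TrivExt k (QuotCat (Shifted.cutIdeal J N))} {f : End X}
    (hf : f.1 ∈ (layer J N 1).hom X.as X.as) : IsNilpotent f := by
  refine ⟨N * 2, ?_⟩
  have h0 : (f ^ N : End X).1 = 0 := eq_zero_of_mem_layer_top h.pow_eq_bot (pow_mem_layer hf N)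
  rw [pow_mul, pow_two, End.mul_def]
  refine Prod.ext ?_ (LinearMap.ext fun g => ?_)
  · rw [TrivExt.comp_fst, h0, Limits.comp_zero]
    rfl
  · rw [TrivExt.comp_snd_apply, h0, Limits.comp_zero, Limits.zero_comp, map_zero, add_zero]
    rfl

/-- An endomorphism is a scalar plus a nilpotent: it is a unit if the scalar is nonzero, and
otherwise its difference from 1 is. -/
theorem isLocalRing_end (h : IsSplitRadical J N isNew isOld)
    (X : TrivExt k (QuotCat (Shifted.cutIdeal J N))) : IsLocalRing (End X) := by
  have hid := h.id_notMem_layer X.as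
  have : Nontrivial (End X) := by
    refine ⟨1, 0, fun h0 => hid ?_⟩
    have h1 : 𝟙 X.as = 0 := congrArg Prod.fst h0
    rw [h1]
    exact zero_mem _
  refine IsLocalRing.of_isUnit_or_isUnit_one_sub_self fun f => ?_
  obtain ⟨c, hc⟩ := h.exists_smul_shift (x := X.as.as.obj) (i := X.as.as.deg) le_rfl f.1
  have hnil : IsNilpotent (f - c • (1 : End X)) := h.isNilpotent_of_mem_layer hc
  by_cases hc0 : c = 0
  · right
    rw [hc0, zero_smul, sub_zero] at hnil
    exact hnil.isUnit_one_sub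
  · left
    have h1 : IsUnit (c • (1 : End X)) :=
      ⟨⟨c • 1, c⁻¹ • 1, by simp [smul_smul, hc0], by simp [smul_smul, hc0]⟩, rfl⟩
    have h2 := hnil.isUnit_add_left_of_commute h1
      (((Commute.one_right f).smul_right c).sub_left ((Commute.refl _)))
    simpa using h2

/-- For an isomorphism between distinct objects, one of the two mutually inverse morphisms would lie
in layer 1, which contains no identity. Finiteness holds because nonzero morphisms only join degrees
that differ by less than `N`. -/
theorem isBasicAlgebra (h : IsSplitRadical J N isNew isOld) :
    IsBasicAlgebra k (TrivExt k (QuotCat (Shifted.cutIdeal J N))) := by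
  have := h.finite_obj
  have := h.finite_hom
  have hfin : ∀ X Y : QuotCat (Shifted.cutIdeal J N), Module.Finite k (X ⟶ Y) := fun X Y =>
    inferInstanceAs (Module.Finite k
      (((J.pow (Y.as.deg - X.as.deg).toNat).hom X.as.obj Y.as.obj) ⧸
        (Shifted.cutIdeal J N).hom X.as Y.as))
  have hdeg : ∀ X Y : TrivExt k (QuotCat (Shifted.cutIdeal J N)), Nontrivial (X ⟶ Y) →
      X.as.as.deg < Y.as.as.deg + N ∧ Y.as.as.deg < X.as.as.deg + N := by
    intro X Y hXY
    by_contra h0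
    have h1 : (∀ f : X.as ⟶ Y.as, f = 0) ∧ ∀ f : Y.as ⟶ X.as, f = 0 := by
      by_cases h2 : X.as.as.deg < Y.as.as.deg + N
      · have h3 : X.as.as.deg + N ≤ Y.as.as.deg := by
          by_contra h3
          exact h0 ⟨h2, by omega⟩
        exact ⟨eq_zero_of_le_deg h.pow_eq_bot h3, eq_zero_of_deg_le (by omega)⟩
      · exact ⟨eq_zero_of_deg_le (by omega), eq_zero_of_le_deg h.pow_eq_bot (by omega)⟩
    obtain ⟨f, g, hfg⟩ := hXY
    refine hfg (Prod.ext ((h1.1 f.1).trans (h1.1 g.1).symm) (LinearMap.ext fun e => ?_))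
    rw [h1.2 e, map_zero, map_zero]
  have himage : ∀ i : ℤ, ((fun p : A × ℤ =>
      (⟨⟨⟨p.1, p.2⟩⟩⟩ : TrivExt k (QuotCat (Shifted.cutIdeal J N)))) ''
        (Set.univ ×ˢ Set.Ioo (i - N) (i + N))).Finite := fun i =>
    (Set.finite_univ.prod (Set.finite_Ioo _ _)).image _
  refine ⟨h.isLocalRing_end, ?_, ?_, ?_, ?_⟩
  · rintro X Y ⟨e⟩
    by_contra hXY
    have h1 : e.hom.1 ≫ e.inv.1 = 𝟙 X.as := congrArg Prod.fst e.hom_inv_id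
    refine h.id_notMem_layer X.as ?_
    rw [← h1]
    rcases lt_trichotomy X.as.as.deg Y.as.as.deg with h2 | h2 | h2
    · exact (layer J N 1).comp_right _ (mem_layer_of_le (by push_cast; omega) _)
    · refine (layer J N 1).comp_right _ (h.mem_layer_one ?_ _)
      intro h3
      obtain ⟨⟨⟨x, i⟩⟩⟩ := X
      obtain ⟨⟨⟨y, j⟩⟩⟩ := Y
      obtain rfl : x = y := h3
      obtain rfl : i = j := h2
      exact hXY rfl
    · exact (layer J N 1).comp_left _ (mem_layer_of_le (by push_cast; omega) _)
  · intro X Y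
    exact inferInstanceAs (Module.Finite k ((X.as ⟶ Y.as) × Module.Dual k (Y.as ⟶ X.as)))
  · intro X
    refine (himage X.as.as.deg).subset fun Y hY => ⟨(Y.as.as.obj, Y.as.as.deg), ?_, rfl⟩
    have := hdeg X Y hY
    exact ⟨trivial, by constructor <;> dsimp only <;> omega⟩
  · intro Y
    refine (himage Y.as.as.deg).subset fun X hX => ⟨(X.as.as.obj, X.as.as.deg), ?_, rfl⟩
    have := hdeg X Y hX
    exact ⟨trivial, by constructor <;> dsimp only <;> omega⟩

theorem isStrictOrder (h : IsSplitRadical J N isNew isOld) :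
    IsStrictOrder (TrivExt k (QuotCat (Shifted.cutIdeal J N)))
      (layerLTD J N isNew isOld) where
  irrefl := by
    rintro X (hX | ⟨-, h1, h2⟩)
    · exact lt_irrefl _ hX
    · exact h.disjoint h1 h2
  trans := by
    rintro X Y Z (hX | ⟨h1, h2, h3⟩) (hY | ⟨h1', h2', h3'⟩)
    · exact Or.inl (hX.trans hY)
    · exact Or.inl (h1' ▸ hX)
    · exact Or.inl (h1 ▸ hY)
    · exact absurd h3 (h.disjoint h2')

theorem interval_finite (h : IsSplitRadical J N isNew isOld)
    (X Y : TrivExt k (QuotCat (Shifted.cutIdeal J N))) :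
    {Z | layerLTD J N isNew isOld X Z ∧ layerLTD J N isNew isOld Z Y}.Finite := by
  have := h.finite_obj
  refine (((Set.finite_univ (α := A)).prod (Set.finite_Icc X.as.as.deg Y.as.as.deg)).image
    (fun p : A × ℤ => (⟨⟨⟨p.1, p.2⟩⟩⟩ : TrivExt k (QuotCat (Shifted.cutIdeal J N))))).subset ?_
  rintro Z ⟨h1, h2⟩
  have hle : ∀ {X Y : TrivExt k (QuotCat (Shifted.cutIdeal J N))},
      layerLTD J N isNew isOld X Y → X.as.as.deg ≤ Y.as.as.deg := by
    rintro X Y (h | ⟨h, -⟩)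
    · exact le_of_lt h
    · exact le_of_eq h
  exact ⟨(Z.as.as.obj, Z.as.as.deg), ⟨trivial, hle h1, hle h2⟩, rfl⟩

theorem finrank_standard_self (h : IsSplitRadical J N isNew isOld)
    (X : TrivExt k (QuotCat (Shifted.cutIdeal J N))) :
    Module.finrank k ((standardModule k (layerLTD J N isNew isOld) X).obj X) = 1 := by
  change Module.finrank k ((X ⟶ X) ⧸ traceSub k (layerLTD J N isNew isOld) X X) = 1
  refine finrank_eq_one (Submodule.Quotient.mk (𝟙 X)) ?_ fun f => ?_
  · rw [Ne, Submodule.Quotient.mk_eq_zero, h.mem_traceD]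
    exact h.id_notMem_layer X.as
  · induction f using Submodule.Quotient.induction_on with
    | _ f =>
      obtain ⟨c, hc⟩ := h.exists_smul_shift (x := X.as.as.obj) (i := X.as.as.deg) le_rfl f.1
      refine ⟨c, ?_⟩
      rw [← Submodule.Quotient.mk_smul, eq_comm, Submodule.Quotient.eq, h.mem_traceD]
      exact hc

/-- In all other cases the degree rises, or the degrees agree and the vertices differ; then every
morphism is in layer 1. -/
theorem eq_or_lt_of_nontrivial_standard (h : IsSplitRadical J N isNew isOld)
    (X Y : TrivExt k (QuotCat (Shifted.cutIdeal J N)))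
    (hXY : Nontrivial ((standardModule k (layerLTD J N isNew isOld) X).obj Y)) :
    Y = X ∨ layerLTD J N isNew isOld Y X := by
  by_contra h0
  rw [not_or] at h0
  refine not_subsingleton_iff_nontrivial.2 hXY ?_
  refine Submodule.Quotient.subsingleton_iff.2 ((Submodule.eq_top_iff').2 fun f => ?_)
  rw [h.mem_traceD]
  rcases lt_trichotomy X.as.as.deg Y.as.as.deg with h2 | h2 | h2
  · exact mem_layer_of_le (by push_cast; omega) _
  · refine h.mem_layer_one ?_ _
    intro h3
    obtain ⟨⟨⟨x, i⟩⟩⟩ := X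
    obtain ⟨⟨⟨y, j⟩⟩⟩ := Y
    obtain rfl : x = y := h3
    obtain rfl : i = j := h2
    exact h0.1 rfl
  · exact absurd (Or.inl h2) h0.2

theorem isQuasiHereditary (h : IsSplitRadical J N isNew isOld) :
    IsQuasiHereditary k (TrivExt k (QuotCat (Shifted.cutIdeal J N)))
      (layerLTD J N isNew isOld) where
  basic := h.isBasicAlgebra
  order := h.isStrictOrder
  interval_finite := h.interval_finite
  standard_self := h.finrank_standard_self
  standard_lt := h.eq_or_lt_of_nontrivial_standard
  filtration := h.hasFiltration_trace

end IsSplitRadical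

end LayerQuasiHereditary

/-! ### Comparison of the standard modules of 𝔇 and ℭ -/

section StandardIso

open QuotCat

variable {k : Type w} [Field k] {A : Type u} [Category.{max v w} A] [Preadditive A] [Linear k A]
variable {J : HomIdeal k A} {N : ℕ} {isNew isOld : A → Prop}

/-- The standard modules of the trivial extension are those of the original category. -/
theorem IsSplitRadical.nonempty_standard_iso (h : IsSplitRadical J N isNew isOld)
    (X : TrivExt k (QuotCat (Shifted.cutIdeal J N))) :
    Nonempty (standardModule k (layerLTD J N isNew isOld) X ≅
      TrivExt.proj k (QuotCat (Shifted.cutIdeal J N)) ⋙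
        standardModule k (layerLT J N isNew isOld) X.as) := by
  let φ : ∀ Y : TrivExt k (QuotCat (Shifted.cutIdeal J N)), (X ⟶ Y) →ₗ[k]
      ((X.as ⟶ Y.as) ⧸ traceSub k (layerLT J N isNew isOld) X.as Y.as) := fun Y =>
    (Submodule.mkQ _) ∘ₗ TrivExt.fstₗ X Y
  -- Both traces are given by layer 1 of the first component.
  have hφ : ∀ Y, traceSub k (layerLTD J N isNew isOld) X Y = LinearMap.ker (φ Y) := by
    intro Y
    ext f
    rw [h.mem_traceD, ← h.traceSub_eq]
    exact (Submodule.Quotient.mk_eq_zero _).symm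
  have hs : ∀ Y, Function.Surjective (φ Y) := fun Y =>
    (Submodule.mkQ_surjective _).comp fun f => ⟨TrivExt.inlₗ X Y f, rfl⟩
  let e : ∀ Y, ((X ⟶ Y) ⧸ traceSub k (layerLTD J N isNew isOld) X Y) ≃ₗ[k]
      ((X.as ⟶ Y.as) ⧸ traceSub k (layerLT J N isNew isOld) X.as Y.as) := fun Y =>
    (Submodule.quotEquivOfEq _ _ (hφ Y)).trans ((φ Y).quotKerEquivOfSurjective (hs Y))
  refine ⟨NatIso.ofComponents (fun Y => (e Y).toModuleIso) ?_⟩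
  intro Y Y' b
  ext f
  induction f using Submodule.Quotient.induction_on with
  | _ f => rfl

end StandardIso

/-! ### Path length and the radical of a quiver algebra -/

section PathAlgebra

variable {k : Type w} [Field k] {W : Type u} [Quiver.{v} W]

theorem HomIdeal.span_le {C : Type u} [Category.{v} C] [Preadditive C] [Linear k C]
    {S : ∀ x y : C, Set (x ⟶ y)} {I : HomIdeal k C} (h : ∀ x y, S x y ⊆ I.hom x y) :
    HomIdeal.span S ≤ I := by
  intro x y
  refine Submodule.span_le.2 ?_
  rintro _ ⟨x', y', a, r, b, hr, rfl⟩
  exact I.comp_left a (I.comp_right b (h _ _ hr))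

theorem HomIdeal.subset_span {C : Type u} [Category.{v} C] [Preadditive C] [Linear k C]
    {S : ∀ x y : C, Set (x ⟶ y)} {x y : C} {f : x ⟶ y} (h : f ∈ S x y) :
    f ∈ (HomIdeal.span (k := k) S).hom x y :=
  Submodule.subset_span ⟨x, y, 𝟙 x, f, 𝟙 y, h, by simp⟩

namespace PathAlgebra

variable (k) in
/-- A path, as an element of the path algebra. -/
noncomputable def ofPath {x y : Free k (Paths W)} (p : Quiver.Path (V := W) x y) : x ⟶ y :=
  Finsupp.single p 1

theorem ofPath_comp {x y z : Free k (Paths W)} (p : Quiver.Path (V := W) x y) (q : Quiver.Path (V := W) y z) :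
    ofPath k p ≫ ofPath k q = ofPath k (p.comp q) := by
  refine (Free.single_comp_single k (C := Paths W) p q 1 1).trans ?_
  rw [one_mul]
  rfl

theorem id_eq_ofPath (x : Free k (Paths W)) :
    𝟙 x = ofPath k (Quiver.Path.nil : Quiver.Path (V := W) x x) := rfl

theorem induction {x y : Free k (Paths W)} {P : (x ⟶ y) → Prop}
    (zero : P 0) (add : ∀ f g, P f → P g → P (f + g)) (smul : ∀ (c : k) f, P f → P (c • f))
    (path : ∀ p : Quiver.Path (V := W) x y, P (ofPath k p))
    (f : x ⟶ y) : P f := by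
  induction f using Finsupp.induction_linear with
  | zero => exact zero
  | add f g hf hg => exact add f g hf hg
  | single p c =>
    have h : (Finsupp.single p c : Quiver.Path (V := W) x y →₀ k) = c • Finsupp.single p 1 := by
      rw [Finsupp.smul_single, smul_eq_mul, mul_one]
    change P (Finsupp.single p c : Quiver.Path (V := W) x y →₀ k)
    rw [h]
    exact smul c _ (path p)

variable (k W) in
/-- The submodules spanned by the paths of length at least `n`. -/
noncomputable def lengthSub (n : ℕ) (x y : Free k (Paths W)) : Submodule k (x ⟶ y) :=
  Submodule.span k {f | ∃ p : Quiver.Path (V := W) x y, n ≤ p.length ∧ f = ofPath k p}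

theorem ofPath_mem_lengthSub {n : ℕ} {x y : Free k (Paths W)} {p : Quiver.Path (V := W) x y} (h : n ≤ p.length) :
    ofPath k p ∈ lengthSub k W n x y := Submodule.subset_span ⟨p, h, rfl⟩

theorem mem_lengthSub_zero {x y : Free k (Paths W)} (f : x ⟶ y) :
    f ∈ lengthSub k W 0 x y := by
  induction f using induction with
  | zero => exact zero_mem _
  | add f g hf hg => exact add_mem hf hg
  | smul c f hf => exact Submodule.smul_mem _ c hf
  | path p => exact ofPath_mem_lengthSub (Nat.zero_le _)

theorem comp_mem_lengthSub {m n : ℕ} {x y z : Free k (Paths W)} {f : x ⟶ y}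
    {g : y ⟶ z} (hf : f ∈ lengthSub k W m x y)
    (hg : g ∈ lengthSub k W n y z) : f ≫ g ∈ lengthSub k W (m + n) x z := by
  induction hf using Submodule.span_induction with
  | mem f h =>
    obtain ⟨p, hp, rfl⟩ := h
    induction hg using Submodule.span_induction with
    | mem g h =>
      obtain ⟨q, hq, rfl⟩ := h
      rw [ofPath_comp]
      exact ofPath_mem_lengthSub 
        ((add_le_add hp hq).trans (Quiver.Path.length_comp (V := W) p q).ge)
    | zero => rw [Limits.comp_zero]; exact zero_mem _
    | add f g _ _ hf hg => rw [Preadditive.comp_add]; exact add_mem hf hg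
    | smul c f _ hf => rw [Linear.comp_smul]; exact Submodule.smul_mem _ c hf
  | zero => rw [Limits.zero_comp]; exact zero_mem _
  | add f g _ _ hf hg => rw [Preadditive.add_comp]; exact add_mem hf hg
  | smul c f _ hf => rw [Linear.smul_comp]; exact Submodule.smul_mem _ c hf

variable (k W) in
/-- The ideal spanned by the paths of length at least `n`. -/
noncomputable def lengthIdeal (n : ℕ) : HomIdeal k (Free k (Paths W)) where
  hom x y := lengthSub k W n x y
  comp_left a _ hf := by simpa using comp_mem_lengthSub (mem_lengthSub_zero a) hf
  comp_right b hf := by simpa using comp_mem_lengthSub hf (mem_lengthSub_zero b)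

theorem arrowIdeal_le : arrowIdeal k W ≤ lengthIdeal k W 1 := by
  refine HomIdeal.span_le ?_
  rintro x y _ ⟨a, rfl⟩
  exact ofPath_mem_lengthSub (p := Quiver.Hom.toPath (V := W) a) le_rfl

theorem ofPath_mem_pow {x y : Free k (Paths W)} (p : Quiver.Path (V := W) x y) :
    ofPath k p ∈ ((arrowIdeal k W).pow p.length).hom x y := by
  induction p with
  | nil => exact Submodule.mem_top
  | cons p a ih =>
    refine Submodule.subset_span ⟨_, ofPath k p, ofPath k (Quiver.Hom.toPath (V := W) a), ih, ?_,
      (ofPath_comp (k := k) (W := W) p (Quiver.Hom.toPath (V := W) a)).symm⟩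
    exact HomIdeal.subset_span ⟨a, rfl⟩

theorem mem_lengthSub_of_forall_le {n : ℕ} {x y : Free k (Paths W)} (h : ∀ p : Quiver.Path (V := W) x y, n ≤ p.length)
    (f : x ⟶ y) : f ∈ lengthSub k W n x y := by
  induction f using induction with
  | zero => exact zero_mem _
  | add f g hf hg => exact add_mem hf hg
  | smul c f hf => exact Submodule.smul_mem _ c hf
  | path p => exact ofPath_mem_lengthSub (h p)

theorem eq_zero_of_length_lt {n : ℕ} {x y : Free k (Paths W)} (h : ∀ p : Quiver.Path (V := W) x y, p.length < n)
    {f : x ⟶ y} (hf : f ∈ lengthSub k W n x y) : f = 0 := by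
  induction hf using Submodule.span_induction with
  | mem f hf =>
    obtain ⟨p, hp, rfl⟩ := hf
    exact absurd (h p) (not_lt.2 hp)
  | zero => rfl
  | add f g _ _ hf hg => rw [hf, hg, add_zero]
  | smul c f _ hf => rw [hf, smul_zero]

theorem id_notMem_lengthSub (x : Free k (Paths W)) :
    𝟙 x ∉ lengthSub k W 1 x x := by
  intro h
  -- The coefficient of the trivial path vanishes on every path of positive length.
  have h0 : lengthSub k W 1 x x ≤
      LinearMap.ker (Finsupp.lapply (Quiver.Path.nil : Quiver.Path (V := W) x x) :
        (Quiver.Path (V := W) x x →₀ k) →ₗ[k] k) := by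
    refine Submodule.span_le.2 ?_
    rintro _ ⟨p, hp, rfl⟩
    refine Finsupp.single_eq_of_ne ?_
    rintro rfl
    exact Nat.not_succ_le_zero 0 hp
  have h1 : (Finsupp.single (Quiver.Path.nil : Quiver.Path (V := W) x x) (1 : k)) Quiver.Path.nil = 0 :=
    h0 h
  rw [Finsupp.single_eq_same] at h1
  exact one_ne_zero h1

theorem exists_scalar {x : Free k (Paths W)} (f : x ⟶ x) :
    ∃ c : k, f - c • 𝟙 x ∈ lengthSub k W 1 x x := by
  induction f using induction with
  | zero => exact ⟨0, by rw [zero_smul, sub_zero]; exact zero_mem _⟩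
  | add f g hf hg =>
    obtain ⟨c, hc⟩ := hf
    obtain ⟨d, hd⟩ := hg
    refine ⟨c + d, ?_⟩
    rw [add_smul, add_sub_add_comm]
    exact add_mem hc hd
  | smul a f hf =>
    obtain ⟨c, hc⟩ := hf
    refine ⟨a * c, ?_⟩
    rw [mul_smul, ← smul_sub]
    exact Submodule.smul_mem _ a hc
  | path p =>
    rcases Nat.eq_zero_or_pos p.length with h | h
    · refine ⟨1, ?_⟩
      rw [Quiver.Path.eq_nil_of_length_zero p h, one_smul, id_eq_ofPath, sub_self]
      exact zero_mem _
    · refine ⟨0, ?_⟩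
      rw [zero_smul, sub_zero]
      exact ofPath_mem_lengthSub h

theorem finite_paths [Finite W] [∀ x y : W, Finite (x ⟶ y)] (n : ℕ) (x y : W) :
    {p : Quiver.Path x y | p.length < n}.Finite := by
  induction n generalizing y with
  | zero => simp
  | succ n ih =>
    have h : (⋃ z : W, ⋃ a : z ⟶ y,
        (fun p : Quiver.Path x z => p.cons a) '' {p | p.length < n}).Finite :=
      Set.finite_iUnion fun z => Set.finite_iUnion fun a => (ih z).image _
    have h0 : {p : Quiver.Path x y | p.length = 0}.Finite := by
      refine Set.Subsingleton.finite fun p hp q hq => ?_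
      obtain rfl := p.eq_of_length_zero hp
      rw [p.eq_nil_of_length_zero hp, q.eq_nil_of_length_zero hq]
    refine (h0.union h).subset fun p hp => ?_
    cases p with
    | nil => exact Or.inl rfl
    | cons p a =>
      refine Or.inr (Set.mem_iUnion.2 ⟨_, Set.mem_iUnion.2 ⟨a, p, ?_, rfl⟩⟩)
      simpa using hp

/-- The ideal of a quiver algebra spanned by the paths of length at least `n`. -/
noncomputable def quotLength (I : HomIdeal k (Free k (Paths W))) (n : ℕ) : HomIdeal k (QuotCat I) where
  hom X Y := ((lengthIdeal k W n).hom X.as Y.as).map (Submodule.mkQ (I.hom X.as Y.as))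
  comp_left := by
    rintro X Y Z a _ ⟨f, hf, rfl⟩
    obtain ⟨a, rfl⟩ := Submodule.mkQ_surjective _ a
    exact ⟨a ≫ f, (lengthIdeal k W n).comp_left a hf, rfl⟩
  comp_right := by
    rintro X Y Z _ b ⟨f, hf, rfl⟩
    obtain ⟨b, rfl⟩ := Submodule.mkQ_surjective _ b
    exact ⟨f ≫ b, (lengthIdeal k W n).comp_right b hf, rfl⟩

section QuotLength

variable {I : HomIdeal k (Free k (Paths W))}

theorem comp_mem_quotLength {m n : ℕ} {X Y Z : QuotCat I} {f : X ⟶ Y} {g : Y ⟶ Z}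
    (hf : f ∈ (quotLength I m).hom X Y) (hg : g ∈ (quotLength I n).hom Y Z) :
    f ≫ g ∈ (quotLength I (m + n)).hom X Z := by
  obtain ⟨f, hf, rfl⟩ := hf
  obtain ⟨g, hg, rfl⟩ := hg
  exact ⟨f ≫ g, comp_mem_lengthSub hf hg, rfl⟩

theorem quotLength_eq_bot {M : ℕ} (hM : lengthIdeal k W M ≤ I) : quotLength I M = ⊥ := by
  ext X Y f
  refine ⟨?_, fun hf => ?_⟩
  · rintro ⟨f, hf, rfl⟩
    exact (Submodule.Quotient.mk_eq_zero _).2 (hM _ _ hf)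
  · rw [show f = 0 from hf]
    exact zero_mem _

theorem pow_mem_quotLength {X : QuotCat I} {f : End X} (hf : f ∈ (quotLength I 1).hom X X)
    (n : ℕ) : (f ^ n : End X) ∈ (quotLength I n).hom X X := by
  induction n with
  | zero => exact ⟨𝟙 X.as, mem_lengthSub_zero _, rfl⟩
  | succ n ih =>
    rw [pow_succ', End.mul_def]
    exact comp_mem_quotLength ih hf

/-- Paths of length at least `M` vanish in the quotient, so `f ≫ g` is nilpotent and `1 - f ≫ g` is
invertible. -/
theorem quotLength_le_radical {M : ℕ} (hM : lengthIdeal k W M ≤ I) :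
    quotLength I 1 ≤ radical k (QuotCat I) := by
  intro X Y f hf g
  have h : IsNilpotent (show End X from f ≫ g) := by
    refine ⟨M, ?_⟩
    have := pow_mem_quotLength ((quotLength I 1).comp_right g hf) M
    rw [quotLength_eq_bot hM] at this
    exact this
  exact (isUnit_iff_isIso _).1 h.isUnit_one_sub

theorem id_notMem_quotLength (hI : I ≤ lengthIdeal k W 1) (X : QuotCat I) :
    𝟙 X ∉ (quotLength I 1).hom X X := by
  rintro ⟨f, hf, hf'⟩
  have h := hI _ _ ((Submodule.Quotient.eq _).1 hf')
  refine id_notMem_lengthSub (k := k) (W := W) X.as ?_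
  have := sub_mem hf h
  rwa [sub_sub_cancel] at this

theorem id_ne_zero (hI : I ≤ lengthIdeal k W 1) (X : QuotCat I) : 𝟙 X ≠ 0 := by
  intro h
  refine id_notMem_quotLength hI X ?_
  rw [h]
  exact zero_mem _

theorem id_notMem_radical (hI : I ≤ lengthIdeal k W 1) (X : QuotCat I) :
    𝟙 X ∉ (radical k (QuotCat I)).hom X X := by
  intro h
  have h1 : IsIso (𝟙 X - 𝟙 X ≫ 𝟙 X) := h (𝟙 X)
  rw [Category.comp_id, sub_self] at h1
  refine id_ne_zero hI X ?_
  rw [← IsIso.hom_inv_id (0 : X ⟶ X), Limits.zero_comp]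

theorem exists_scalar_quotLength {X : QuotCat I} (f : X ⟶ X) :
    ∃ c : k, f - c • 𝟙 X ∈ (quotLength I 1).hom X X := by
  obtain ⟨f, rfl⟩ := Submodule.mkQ_surjective _ f
  obtain ⟨c, hc⟩ := exists_scalar (k := k) (W := W) f
  exact ⟨c, _, hc, rfl⟩

theorem mem_quotLength_of_ne {X Y : QuotCat I} (h : X ≠ Y) (f : X ⟶ Y) :
    f ∈ (quotLength I 1).hom X Y := by
  obtain ⟨f, rfl⟩ := Submodule.mkQ_surjective _ f
  refine ⟨f, mem_lengthSub_of_forall_le (fun p => ?_) f, rfl⟩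
  by_contra hp
  obtain ⟨x⟩ := X
  obtain ⟨y⟩ := Y
  obtain rfl : x = y := p.eq_of_length_zero (by omega)
  exact h rfl

/-- Between distinct vertices all paths have positive length. An endomorphism is a scalar modulo
positive length, and a nonzero scalar would put the identity into the radical. -/
theorem radical_eq (hI : I ≤ lengthIdeal k W 1) {M : ℕ} (hM : lengthIdeal k W M ≤ I) :
    radical k (QuotCat I) = quotLength I 1 := by
  ext X Y f
  refine ⟨fun hf => ?_, fun hf => quotLength_le_radical hM _ _ hf⟩
  by_cases hXY : X = Y
  · subst hXY
    obtain ⟨c, hc⟩ := exists_scalar_quotLength f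
    by_cases hc0 : c = 0
    · rwa [hc0, zero_smul, sub_zero] at hc
    · refine absurd ?_ (id_notMem_radical hI X)
      have h := sub_mem hf (quotLength_le_radical hM _ _ hc)
      rw [sub_sub_cancel] at h
      have h' := Submodule.smul_mem _ c⁻¹ h
      rwa [smul_smul, inv_mul_cancel₀ hc0, one_smul] at h'
  · exact mem_quotLength_of_ne hXY f

theorem pow_quotLength_le (n : ℕ) : (quotLength I 1).pow n ≤ quotLength I n := by
  induction n with
  | zero =>
    intro X Y f _
    obtain ⟨f, rfl⟩ := Submodule.mkQ_surjective _ f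
    exact ⟨f, mem_lengthSub_zero f, rfl⟩
  | succ n ih =>
    intro X Y
    refine Submodule.span_le.2 ?_
    rintro _ ⟨Z, a, b, ha, hb, rfl⟩
    exact comp_mem_quotLength (ih _ _ ha) hb

/-- The infimum defining the nilpotency degree is attained, because `M` belongs to the set. -/
theorem radical_pow_eq_bot (hI : I ≤ lengthIdeal k W 1) {M : ℕ} (hM : lengthIdeal k W M ≤ I) :
    (radical k (QuotCat I)).pow (radical k (QuotCat I)).nilpotencyDegree = ⊥ := by
  refine Nat.sInf_mem (s := {n | (radical k (QuotCat I)).pow n = ⊥}) ⟨M, ?_⟩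
  have h : (radical k (QuotCat I)).pow M ≤ ⊥ := by
    rw [radical_eq hI hM, ← quotLength_eq_bot hM]
    exact pow_quotLength_le M
  ext X Y f
  refine ⟨fun hf => h X Y hf, fun hf => ?_⟩
  rw [show f = 0 from hf]
  exact zero_mem _

theorem finite_hom [Finite W] [∀ x y : W, Finite (x ⟶ y)] {M : ℕ} (hM : lengthIdeal k W M ≤ I)
    (X Y : QuotCat I) : Module.Finite k (X ⟶ Y) := by
  let S : Set (X ⟶ Y) := (fun p : Quiver.Path (V := W) X.as Y.as =>
    (Submodule.Quotient.mk (ofPath k p) : (X.as ⟶ Y.as) ⧸ I.hom X.as Y.as)) '' {p | p.length < M}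
  refine ⟨Submodule.fg_def.2 ⟨S, (finite_paths M _ _).image _, (Submodule.eq_top_iff').2 fun f => ?_⟩⟩
  obtain ⟨f, rfl⟩ := Submodule.mkQ_surjective _ f
  induction f using induction with
  | zero => exact zero_mem _
  | add f g hf hg => exact add_mem hf hg
  | smul c f hf => exact Submodule.smul_mem _ c hf
  | path p =>
    by_cases hp : p.length < M
    · exact Submodule.subset_span ⟨p, hp, rfl⟩
    · have h : Submodule.mkQ (I.hom X.as Y.as) (ofPath k p) = 0 :=
        (Submodule.Quotient.mk_eq_zero _).2 (hM _ _ (ofPath_mem_lengthSub (not_lt.1 hp)))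
      change Submodule.mkQ (I.hom X.as Y.as) (ofPath k p) ∈ Submodule.span k S
      rw [h]
      exact zero_mem _

end QuotLength

end PathAlgebra

end PathAlgebra

/-! ### The extended quiver and the last power of the radical -/

section Tilde

open PathAlgebra

variable {k : Type w} [Field k] {V : Type u} [Quiver.{v} V]

instance [Finite V] : Finite (TildeVertex V) := by
  let f : V ⊕ V → TildeVertex V := Sum.elim .old .new
  refine Finite.of_surjective f ?_
  rintro (x | x)
  · exact ⟨Sum.inl x, rfl⟩
  · exact ⟨Sum.inr x, rfl⟩

theorem finite_tildeArrow [∀ x y : V, Finite (x ⟶ y)] (X Y : TildeVertex V) : Finite (X ⟶ Y) := by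
  rcases X with x | x <;> rcases Y with y | y
  · refine Finite.of_surjective (fun a : x ⟶ y => (TildeArrow.old a : TildeArrow (.old x) (.old y)))
      ?_
    rintro ⟨a⟩
    exact ⟨a, rfl⟩
  · refine @Finite.of_subsingleton _ ⟨fun a b => ?_⟩
    change TildeArrow (.old x) (.new y) at a b
    cases a
    cases b
    rfl
  · refine @Finite.of_subsingleton _ ⟨fun a => ?_⟩
    change TildeArrow (.new x) (.old y) at a
    cases a
  · refine @Finite.of_subsingleton _ ⟨fun a => ?_⟩
    change TildeArrow (.new x) (.new y) at a
    cases a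

/-- New vertices are sinks, so a new arrow can only be the last one of a path. The end vertex is
kept variable, with transports, so that induction on the path applies. -/
theorem tilde_path_old {x : V} {Y : TildeVertex V} (p : Quiver.Path (TildeVertex.old x) Y) :
    (∀ y (e : Y = .old y), ∃ q : Quiver.Path x y,
      (e ▸ p : Quiver.Path (TildeVertex.old x) (.old y)) = (tildeInclusion V).mapPath q) ∧
      ∀ y (e : Y = .new y), ∃ q : Quiver.Path (TildeVertex.old x) (.old y),
        (e ▸ p : Quiver.Path (TildeVertex.old x) (.new y)) = q.cons (TildeArrow.new y) := by
  induction p with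
  | nil =>
    refine ⟨fun y e => ?_, fun y e => by cases e⟩
    cases e
    exact ⟨.nil, rfl⟩
  | cons p a ih =>
    change TildeArrow _ _ at a
    cases a with
    | old a =>
      refine ⟨fun y e => ?_, fun y e => by cases e⟩
      cases e
      obtain ⟨q, hq⟩ := ih.1 _ rfl
      exact ⟨q.cons a, congrArg (fun p => Quiver.Path.cons p (TildeArrow.old a)) hq⟩
    | new y =>
      refine ⟨fun y e => (by cases e), fun y e => ?_⟩
      cases e
      exact ⟨p, rfl⟩

theorem exists_mapPath_eq {x y : V} (p : Quiver.Path (TildeVertex.old x) (.old y)) :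
    ∃ q : Quiver.Path x y, p = (tildeInclusion V).mapPath q := (tilde_path_old p).1 y rfl

theorem exists_cons_eq {x y : V} (p : Quiver.Path (TildeVertex.old x) (.new y)) :
    ∃ q : Quiver.Path (TildeVertex.old x) (.old y), p = q.cons (TildeArrow.new y) :=
  (tilde_path_old p).2 y rfl

theorem length_of_new {x : V} {Y : TildeVertex V} (p : Quiver.Path (TildeVertex.new x) Y) :
    p.length = 0 := by
  induction p with
  | nil => rfl
  | cons p a ih =>
    have h := p.eq_of_length_zero ih
    subst h
    change TildeArrow (.new x) _ at a
    cases a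

theorem length_mapPath {x y : V} (p : Quiver.Path x y) :
    ((tildeInclusion V).mapPath p).length = p.length := by
  induction p with
  | nil => rfl
  | cons p a ih => exact congrArg (· + 1) ih

variable (k) in
/-- An old vertex, as an object of the path algebra. -/
def oldObj (x : Free k (Paths V)) : Free k (Paths (TildeVertex V)) := TildeVertex.old x

variable (k) in
/-- A new vertex, as an object of the path algebra. -/
def newObj (x : Free k (Paths V)) : Free k (Paths (TildeVertex V)) := TildeVertex.new x

theorem eq_oldObj_or_newObj {k : Type w} {V : Type u} (X : Free k (Paths (TildeVertex V))) :
    (∃ x, X = oldObj k x) ∨ ∃ x, X = newObj k x := by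
  change TildeVertex V at X
  rcases X with x | x
  · exact Or.inl ⟨x, rfl⟩
  · exact Or.inr ⟨x, rfl⟩

/-- The inclusion of the path algebra in that of the extended quiver. -/
noncomputable def tildeMap (x y : Free k (Paths V)) :
    (x ⟶ y) →ₗ[k] (oldObj k x ⟶ oldObj k y) :=
  Finsupp.lmapDomain k k fun p : Quiver.Path (V := V) x y => (tildeInclusion V).mapPath p

theorem tildeMap_ofPath {x y : Free k (Paths V)} (p : Quiver.Path (V := V) x y) :
    tildeMap x y (ofPath k p) =
      ofPath k (x := oldObj k x) (y := oldObj k y) ((tildeInclusion V).mapPath p) :=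
  Finsupp.mapDomain_single

theorem tildeMap_comp {x y z : Free k (Paths V)} (f : x ⟶ y) (g : y ⟶ z) :
    tildeMap x z (f ≫ g) = tildeMap x y f ≫ tildeMap y z g := by
  induction f using PathAlgebra.induction with
  | zero => rw [Limits.zero_comp, map_zero, map_zero, Limits.zero_comp]
  | add f f' hf hf' => rw [Preadditive.add_comp, map_add, map_add, Preadditive.add_comp, hf, hf']
  | smul c f hf => rw [Linear.smul_comp, map_smul, map_smul, Linear.smul_comp, hf]
  | path p =>
    induction g using PathAlgebra.induction with
    | zero => rw [Limits.comp_zero, map_zero, map_zero, Limits.comp_zero]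
    | add f f' hf hf' => rw [Preadditive.comp_add, map_add, map_add, Preadditive.comp_add, hf, hf']
    | smul c f hf => rw [Linear.comp_smul, map_smul, map_smul, Linear.comp_smul, hf]
    | path q =>
      rw [ofPath_comp, tildeMap_ofPath, tildeMap_ofPath, tildeMap_ofPath]
      refine Eq.trans ?_ (ofPath_comp _ _).symm
      exact congrArg (ofPath k (x := oldObj k x) (y := oldObj k z))
        (Prefunctor.mapPath_comp (tildeInclusion V) p q)

variable {R : ∀ x y : V, Set (Quiver.Path x y →₀ k)}

theorem tildeMap_mem {x y : Free k (Paths V)} {f : x ⟶ y}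
    (hf : f ∈ (relIdeal R).hom x y) :
    tildeMap x y f ∈ (relIdeal (tildeRel R)).hom (oldObj k x) (oldObj k y) := by
  induction hf using Submodule.span_induction with
  | mem f h =>
    obtain ⟨x', y', a, r, b, hr, rfl⟩ := h
    rw [tildeMap_comp, tildeMap_comp]
    exact Submodule.subset_span ⟨oldObj k x', oldObj k y', _, _, _, ⟨r, hr, rfl⟩, rfl⟩
  | zero => rw [map_zero]; exact zero_mem _
  | add f g _ _ hf hg => rw [map_add]; exact add_mem hf hg
  | smul c f _ hf => rw [map_smul]; exact Submodule.smul_mem _ c hf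

theorem tildeMap_mem_lengthSub {n : ℕ} {x y : Free k (Paths V)} {f : x ⟶ y}
    (hf : f ∈ lengthSub k V n x y) :
    tildeMap x y f ∈ lengthSub k (TildeVertex V) n (oldObj k x) (oldObj k y) := by
  induction hf using Submodule.span_induction with
  | mem f h =>
    obtain ⟨p, hp, rfl⟩ := h
    rw [tildeMap_ofPath]
    exact ofPath_mem_lengthSub (hp.trans (length_mapPath p).ge)
  | zero => rw [map_zero]; exact zero_mem _
  | add f g _ _ hf hg => rw [map_add]; exact add_mem hf hg
  | smul c f _ hf => rw [map_smul]; exact Submodule.smul_mem _ c hf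

/-- Every extended relation is the image of an old one, which lies in the square of the arrow ideal.
Positive length suffices to keep identities out of the ideal. -/
theorem relIdeal_tildeRel_le (hR : IsAdmissible R) :
    relIdeal (tildeRel R) ≤ lengthIdeal k (TildeVertex V) 1 := by
  refine HomIdeal.span_le ?_
  intro X Y r hr
  rcases eq_oldObj_or_newObj X with ⟨x, rfl⟩ | ⟨x, rfl⟩ <;>
    rcases eq_oldObj_or_newObj Y with ⟨y, rfl⟩ | ⟨y, rfl⟩
  · obtain ⟨r, hr, rfl⟩ := hr
    have h1 : (r : @Quiver.Hom (Free k (Paths V)) _ x y) ∈ ((arrowIdeal k V).pow 2).hom x y :=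
      hR.1 x y (HomIdeal.subset_span hr)
    have h2 := (arrowIdeal k V).pow_anti (show 1 ≤ 2 by omega) _ _ h1
    have h2 := ((arrowIdeal k V).pow_one_hom _ _).le h2
    exact tildeMap_mem_lengthSub (arrowIdeal_le _ _ h2)
  · exact absurd hr (Set.notMem_empty r)
  · exact absurd hr (Set.notMem_empty r)
  · exact absurd hr (Set.notMem_empty r)

/-- The arrow `y ⟶ ỹ` as an element of the path algebra. -/
noncomputable def newArrow (k : Type w) [Field k] (y : Free k (Paths V)) : oldObj k y ⟶ newObj k y :=
  ofPath k (Quiver.Hom.toPath (V := TildeVertex V) (TildeArrow.new (show V from y)))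

/-- Composition of paths with the arrow `y ⟶ ỹ`. -/
def consNew (X : Free k (Paths (TildeVertex V))) (y : Free k (Paths V))
    (p : Quiver.Path (V := TildeVertex V) X (oldObj k y)) :
    Quiver.Path (V := TildeVertex V) X (newObj k y) :=
  Quiver.Path.cons (V := TildeVertex V) p (TildeArrow.new (show V from y))

theorem ofPath_comp_newArrow {X : Free k (Paths (TildeVertex V))} {y : Free k (Paths V)}
    (p : Quiver.Path (V := TildeVertex V) X (oldObj k y)) :
    ofPath k p ≫ newArrow k y = ofPath k (consNew X y p) := ofPath_comp _ _

/-- If `m` works for the old quiver, `m + 1` works here: removing a possible final new arrow leaves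
at least `m` old ones. -/
theorem exists_lengthIdeal_le (hR : IsAdmissible R) :
    ∃ M, lengthIdeal k (TildeVertex V) M ≤ relIdeal (tildeRel R) := by
  obtain ⟨m, hm⟩ := hR.2
  have h : ∀ {x y : Free k (Paths V)} (q : Quiver.Path (V := V) x y), m ≤ q.length →
      ofPath k (x := oldObj k x) (y := oldObj k y) ((tildeInclusion V).mapPath q) ∈
        (relIdeal (tildeRel R)).hom (oldObj k x) (oldObj k y) := by
    intro x y q hq
    rw [← tildeMap_ofPath]
    exact tildeMap_mem (hm _ _ ((arrowIdeal k V).pow_anti hq _ _ (ofPath_mem_pow q)))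
  refine ⟨m + 1, fun X Y => Submodule.span_le.2 ?_⟩
  rintro _ ⟨p, hp, rfl⟩
  rcases eq_oldObj_or_newObj X with ⟨x, rfl⟩ | ⟨x, rfl⟩
  · rcases eq_oldObj_or_newObj Y with ⟨y, rfl⟩ | ⟨y, rfl⟩
    · obtain ⟨q, rfl⟩ := exists_mapPath_eq p
      have hq : m + 1 ≤ q.length := hp.trans (length_mapPath q).le
      exact h q (by omega)
    · obtain ⟨p, rfl⟩ := exists_cons_eq p
      obtain ⟨q, rfl⟩ := exists_mapPath_eq p
      have hq : m + 1 ≤ q.length + 1 := hp.trans (Nat.succ_le_succ (length_mapPath q).le)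
      have h1 := (relIdeal (tildeRel R)).comp_right (newArrow k y) (h q (by omega))
      have h2 := ofPath_comp_newArrow (k := k) (X := oldObj k x) (y := y)
        ((tildeInclusion V).mapPath q)
      exact Eq.mp (congrArg (fun f => f ∈ (relIdeal (tildeRel R)).hom _ _) h2) h1
  · exact absurd (hp.trans (length_of_new p).le) (Nat.not_succ_le_zero m)

/-- Appending a fixed arrow is injective on paths, hence on their linear combinations. -/
theorem eq_zero_of_comp_newArrow {X : Free k (Paths (TildeVertex V))} {y : Free k (Paths V)}
    (f : X ⟶ oldObj k y) (hf : f ≫ newArrow k y = 0) : f = 0 := by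
  let L : (X ⟶ oldObj k y) →ₗ[k] (X ⟶ newObj k y) := Finsupp.lmapDomain k k (consNew X y)
  have h : ∀ f : X ⟶ oldObj k y, f ≫ newArrow k y = L f := by
    intro f
    induction f using PathAlgebra.induction with
    | zero => rw [Limits.zero_comp, map_zero]
    | add f g hf hg => rw [Preadditive.add_comp, hf, hg, map_add]
    | smul c f hf => rw [Linear.smul_comp, hf, map_smul]
    | path p =>
      rw [ofPath_comp_newArrow]
      exact Finsupp.mapDomain_single.symm
  have h1 : Function.Injective (consNew X y) := fun p q hpq =>
    eq_of_heq (Quiver.Path.heq_of_cons_eq_cons hpq)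
  have h2 : Function.Injective L := Finsupp.mapDomain_injective h1
  rw [h] at hf
  exact h2 (hf.trans (map_zero L).symm)

theorem exists_comp_newArrow {x y : Free k (Paths V)}
    (f : oldObj k x ⟶ newObj k y) : ∃ g, f = g ≫ newArrow k y := by
  induction f using PathAlgebra.induction with
  | zero => exact ⟨0, (Limits.zero_comp).symm⟩
  | add f g hf hg =>
    obtain ⟨f', rfl⟩ := hf
    obtain ⟨g', rfl⟩ := hg
    exact ⟨f' + g', (Preadditive.add_comp _ _ _ _ _ _).symm⟩
  | smul c f hf =>
    obtain ⟨f', rfl⟩ := hf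
    exact ⟨c • f', (Linear.smul_comp _ _ _ _ _ _).symm⟩
  | path p =>
    obtain ⟨q, rfl⟩ := exists_cons_eq p
    exact ⟨ofPath k q, (ofPath_comp_newArrow (X := oldObj k x) q).symm⟩

/-- Relations only join old vertices, so in a generator `a ≫ r ≫ b` of the ideal the factor `b` runs
from an old vertex to ỹ; its final new arrow splits off, and the rest stays in the ideal. -/
theorem exists_mem_relIdeal_comp_newArrow {X : Free k (Paths (TildeVertex V))} {y : Free k (Paths V)}
    {f : X ⟶ newObj k y}
    (hf : f ∈ (relIdeal (tildeRel R)).hom X (newObj k y)) :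
    ∃ g ∈ (relIdeal (tildeRel R)).hom X (oldObj k y), f = g ≫ newArrow k y := by
  induction hf using Submodule.span_induction with
  | mem f h =>
    obtain ⟨x', y', a, r, b, hr, rfl⟩ := h
    rcases eq_oldObj_or_newObj x' with ⟨x', rfl⟩ | ⟨x', rfl⟩ <;>
      rcases eq_oldObj_or_newObj y' with ⟨y', rfl⟩ | ⟨y', rfl⟩
    · obtain ⟨b, rfl⟩ := exists_comp_newArrow b
      exact ⟨a ≫ r ≫ b, Submodule.subset_span ⟨_, _, a, r, b, hr, rfl⟩, by simp⟩
    · exact absurd hr (Set.notMem_empty r)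
    · exact absurd hr (Set.notMem_empty r)
    · exact absurd hr (Set.notMem_empty r)
  | zero => exact ⟨0, zero_mem _, (Limits.zero_comp).symm⟩
  | add f g _ _ hf hg =>
    obtain ⟨f', hf, rfl⟩ := hf
    obtain ⟨g', hg, rfl⟩ := hg
    exact ⟨f' + g', add_mem hf hg, (Preadditive.add_comp _ _ _ _ _ _).symm⟩
  | smul c f _ hf =>
    obtain ⟨f', hf, rfl⟩ := hf
    exact ⟨c • f', Submodule.smul_mem _ c hf, (Linear.smul_comp _ _ _ _ _ _).symm⟩

/-- The arrow `y ⟶ ỹ` as an element of the algebra `Ã`. -/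
noncomputable def newArrowQuot (R : ∀ x y : V, Set (Quiver.Path x y →₀ k)) (y : Free k (Paths V)) :
    (⟨oldObj k y⟩ : TildeAlgebra R) ⟶ ⟨newObj k y⟩ :=
  Submodule.Quotient.mk (p := (relIdeal (tildeRel R)).hom (oldObj k y) (newObj k y)) (newArrow k y)

/-- This is the purpose of the new vertices: no relation involves the new arrow, so composition with
it remains injective in Ã. -/
theorem eq_zero_of_comp_newArrowQuot {X : TildeAlgebra R} {y : Free k (Paths V)} (f : X ⟶ ⟨oldObj k y⟩)
    (hf : f ≫ newArrowQuot R y = 0) : f = 0 := by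
  obtain ⟨f, rfl⟩ := Submodule.mkQ_surjective _ f
  have hf' : f ≫ newArrow k y ∈ (relIdeal (tildeRel R)).hom X.as (newObj k y) :=
    (Submodule.Quotient.mk_eq_zero _).1 hf
  obtain ⟨g, hg, hfg⟩ := exists_mem_relIdeal_comp_newArrow hf'
  have h : f - g = 0 := by
    refine eq_zero_of_comp_newArrow _ ?_
    rw [Preadditive.sub_comp, sub_eq_zero]
    exact hfg
  rw [sub_eq_zero.1 h]
  exact (Submodule.Quotient.mk_eq_zero _).2 hg

theorem newArrowQuot_mem (hR : IsAdmissible R) (y : Free k (Paths V)) :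
    newArrowQuot R y ∈ (radical k (TildeAlgebra R)).hom ⟨oldObj k y⟩ ⟨newObj k y⟩ := by
  obtain ⟨M, hM⟩ := exists_lengthIdeal_le hR
  refine quotLength_le_radical hM _ _ (mem_quotLength_of_ne ?_ _)
  intro h
  have h' : oldObj k y = newObj k y := congrArg QuotCat.as h
  change TildeVertex.old (show V from y) = TildeVertex.new y at h'
  cases h'

theorem eq_zero_of_new {x : Free k (Paths V)} {Y : TildeAlgebra R} {f : (⟨newObj k x⟩ : TildeAlgebra R) ⟶ Y}
    (hf : f ∈ (quotLength (relIdeal (tildeRel R)) 1).hom ⟨newObj k x⟩ Y) : f = 0 := by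
  obtain ⟨f, hf, rfl⟩ := hf
  have h : f = 0 := 
    eq_zero_of_length_lt (fun p => (length_of_new p).le.trans_lt Nat.zero_lt_one) hf
  rw [h, map_zero]

/-- The object of `Ã` is a new vertex. -/
def IsNewVertex {R : ∀ x y : V, Set (Quiver.Path x y →₀ k)} (X : TildeAlgebra R) : Prop :=
  ∃ l : V, @Eq (TildeVertex V) X.as (.new l)

/-- The object of `Ã` is an old vertex. -/
def IsOldVertex {R : ∀ x y : V, Set (Quiver.Path x y →₀ k)} (X : TildeAlgebra R) : Prop :=
  ∃ m : V, @Eq (TildeVertex V) X.as (.old m)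

theorem firstLT_eq (R : ∀ x y : V, Set (Quiver.Path x y →₀ k)) : firstLT R =
    layerLT (radical k (TildeAlgebra R)) (radical k (TildeAlgebra R)).nilpotencyDegree
      IsNewVertex IsOldVertex := rfl

theorem firstLTD_eq (R : ∀ x y : V, Set (Quiver.Path x y →₀ k)) : firstLTD R =
    layerLTD (radical k (TildeAlgebra R)) (radical k (TildeAlgebra R)).nilpotencyDegree
      IsNewVertex IsOldVertex := rfl

/-- The essential field is `last_layer`. An element of J^(N-1) ending at an old vertex y gives an
element of J^N = 0 after composition with y → ỹ, so it is zero. One starting at a new vertex is a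
radical element leaving a sink, so it is zero too. -/
theorem isSplitRadical [Finite V] [∀ x y : V, Finite (x ⟶ y)] (hR : IsAdmissible R) :
    IsSplitRadical (radical k (TildeAlgebra R)) (radical k (TildeAlgebra R)).nilpotencyDegree
      IsNewVertex IsOldVertex := by
  have hI := relIdeal_tildeRel_le hR
  obtain ⟨M, hM⟩ := exists_lengthIdeal_le hR
  have hN := radical_pow_eq_bot hI hM
  have : ∀ X Y : TildeVertex V, Finite (X ⟶ Y) := finite_tildeArrow
  have hlast : ∀ {X Y : TildeAlgebra R} (f : Y ⟶ X),
      f ∈ ((radical k (TildeAlgebra R)).pow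
        ((radical k (TildeAlgebra R)).nilpotencyDegree - 1)).hom Y X → f ≠ 0 →
      IsNewVertex X ∧ IsOldVertex Y := by
    rintro ⟨X⟩ ⟨Y⟩ f hf hf0
    rcases eq_oldObj_or_newObj X with ⟨x, rfl⟩ | ⟨x, rfl⟩
    · refine absurd (eq_zero_of_comp_newArrowQuot f ?_) hf0
      have h := (radical k (TildeAlgebra R)).comp_mem_pow (n := 1)
        (l := (radical k (TildeAlgebra R)).nilpotencyDegree) (by omega) hf
        (by rw [HomIdeal.pow_one_hom]; exact newArrowQuot_mem hR x)
      rw [hN] at h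
      exact h
    · refine ⟨⟨x, rfl⟩, ?_⟩
      rcases eq_oldObj_or_newObj Y with ⟨y, rfl⟩ | ⟨y, rfl⟩
      · exact ⟨y, rfl⟩
      -- The new arrow at `x` is a nonzero element of the radical; hence N ≥ 2, so that J^(N-1) is
      -- contained in J.
      · have hN2 : 2 ≤ (radical k (TildeAlgebra R)).nilpotencyDegree := by
          by_contra hlt
          have h1 : newArrowQuot R x ∈ ((radical k (TildeAlgebra R)).pow 1).hom _ _ := by
            rw [HomIdeal.pow_one_hom]
            exact newArrowQuot_mem hR x
          have h2 := (radical k (TildeAlgebra R)).pow_anti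
            (show (radical k (TildeAlgebra R)).nilpotencyDegree ≤ 1 by omega) _ _ h1
          rw [hN] at h2
          refine id_ne_zero hI ⟨oldObj k x⟩ (eq_zero_of_comp_newArrowQuot (R := R) _ ?_)
          rw [Category.id_comp]
          exact h2
        have h3 := (radical k (TildeAlgebra R)).pow_anti
          (show 1 ≤ (radical k (TildeAlgebra R)).nilpotencyDegree - 1 by omega) _ _ hf
        rw [HomIdeal.pow_one_hom, radical_eq hI hM] at h3
        exact absurd (eq_zero_of_new h3) hf0
  refine
    { finite_obj := Finite.of_injective (fun X : TildeAlgebra R => (show TildeVertex V from X.as)) ?_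
      finite_hom := finite_hom hM
      pow_eq_bot := hN
      mem_of_ne := fun h f => quotLength_le_radical hM _ _ (mem_quotLength_of_ne h f)
      exists_scalar := fun f => ?_
      one_notMem := id_notMem_radical hI
      last_layer := hlast
      disjoint := ?_ }
  · rintro ⟨X⟩ ⟨Y⟩ h
    exact congrArg QuotCat.mk h
  · obtain ⟨c, hc⟩ := exists_scalar_quotLength f
    exact ⟨c, quotLength_le_radical hM _ _ hc⟩
  · rintro ⟨X⟩ ⟨l, h⟩ ⟨m, h'⟩
    have := h.symm.trans h'
    cases this

end Tilde

end QHEnvelope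

theorem proposition3p2 {k : Type w} [Field k] [IsAlgClosed k]
    {V : Type u} [Finite V] [Quiver.{v} V] [∀ x y : V, Finite (x ⟶ y)]
    (R : ∀ x y : V, Set (Quiver.Path x y →₀ k)) (hR : QHEnvelope.IsAdmissible R) :
    QHEnvelope.IsSymmetric k (QHEnvelope.TildeD R) ∧
    QHEnvelope.IsQuasiHereditary k (QHEnvelope.TildeD R) (QHEnvelope.firstLTD R) ∧
    ∀ X : QHEnvelope.TildeD R,
      Nonempty (QHEnvelope.standardModule k (QHEnvelope.firstLTD R) X ≅
        QHEnvelope.TrivExt.proj k (QHEnvelope.TildeC R) ⋙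
          QHEnvelope.standardModule k (QHEnvelope.firstLT R) X.as) := by
  have h := QHEnvelope.isSplitRadical hR
  exact ⟨QHEnvelope.TrivExt.isSymmetric, QHEnvelope.firstLTD_eq R ▸ h.isQuasiHereditary, by
    rw [QHEnvelope.firstLTD_eq R, QHEnvelope.firstLT_eq R]
    exact QHEnvelope.IsSplitRadical.nonempty_standard_iso.{w, max u v, u} h⟩
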